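/- Let $k$ be an algebraically closed field, $Q$ a finite connected quiver without oriented cycles, and $\sigma$ an automorphism of $Q$ of order $n$, where the characteristic of $k$ does not divide $n$. Let $\sigma$ also denote the induced automorphism of the path algebra $kQ$. For $j\ge 0$ and a $kQ$-module $X$ let ${}^{\sigma^j}X$ be the $kQ$-module with the same underlying vector space and the action $p\cdot x=\sigma^{-j}(p)x$. For $j\geq 0$ let $kQ\#k\langle\sigma^j\rangle$ be the skew group algebra, with product $(p\#g)(q\#h)=p\,g(q)\#gh$. Let $X$ be a finitely generated indecomposable $kQ$-module and let $m\ge 1$ be minimal with ${}^{\sigma^m}X\cong X$. Then $r=n/m$ is an integer, it is the order of $\sigma^m$, and there is a $kQ$-isomorphism $\varphi:{}^{\sigma^m}X\to X$ whose $r$-fold iterate, as a map of the set $X$, is the identity. Fix any such $\varphi$ and a primitive $r$-th root of unity $\zeta\in k$. Then $X$ is a $kQ\#k\langle\sigma^m\rangle$-module via $(p\#\sigma^{mj})x=p\,\varphi^j(x)$. For $i=1,\dots,r$ let $L_i=k$ be the $k\langle\sigma^m\rangle$-module on which $\sigma^m$ acts as multiplication by $\zeta^i$, and let $kQ\#k\langle\sigma^m\rangle$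 act on $L_i\otimes_kX$ by $(p\#\sigma^{mj})(c\otimes x)=\zeta^{ij}c\otimes p\,\varphi^j(x)$. Put $$M_i=(kQ\#k\langle\sigma\rangle)\otimes_{kQ\#k\langle\sigma^m\rangle}(L_i\otimes_kX).$$ Then: (i) $M_i\cong X\oplus{}^{\sigma}X\oplus\cdots\oplus{}^{\sigma^{m-1}}X$ as $kQ$-modules, for $i=1,\dots,r$; (ii) $M_i$ is an indecomposable $kQ\#k\langle\sigma\rangle$-module, for $i=1,\dots,r$; (iii) $M_i\not\cong M_j$ as $kQ\#k\langle\sigma\rangle$-modules if $i\ne j$; (iv) $(kQ\#k\langle\sigma\rangle)\otimes_{kQ}X\cong\bigoplus_{i=1}^rM_i$ as $kQ\#k\langle\sigma\rangle$-modules; (v) for every $kQ\#k\langle\sigma\rangle$-module $Y$ with $Y\cong X\oplus{}^{\sigma}X\oplus\cdots\oplus{}^{\sigma^{m-1}}X$ as $kQ$-modules there is a unique $i\in\{1,\dots,r\}$ with $Y\cong M_i$ as $kQ\#k\langle\sigma\rangle$-modules. Hence there are exactly $r$ isomorphism classes of $kQ\#k\langle\sigma\rangle$-modules whose restriction to $kQ$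 is isomorphic to $X\oplus{}^{\sigma}X\oplus\cdots\oplus{}^{\sigma^{m-1}}X$. -/

import Mathlib

open scoped TensorProduct DirectSum
open CategoryTheory

universe u v w x y

noncomputable section

/-! ### Path algebras and quiver automorphisms -/

/-- The paths (of length `≥ 0`) of a quiver `Q`, from an arbitrary start vertex `src` to an
arbitrary end vertex `tgt`. -/
structure AllPaths (Q : Type u) [Quiver.{v} Q] : Type (max u v) where
  /-- the start vertex -/
  src : Q
  /-- the end vertex -/
  tgt : Q
  /-- the path -/
  path : Quiver.Path src tgt

/-- The path algebra `kQ`: the `k`-vector space with basis the set of paths of `Q`. -/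
def PathAlgebra (k : Type w) [Field k] (Q : Type u) [Quiver.{v} Q] : Type (max u v w) :=
  AllPaths Q →₀ k

/-- The group of automorphisms of the quiver `Q`, with `(σ * τ) a = σ (τ a)`. -/
abbrev QuiverAut (Q : Type u) [Quiver.{v} Q] : Type (max u v) := Aut (Quiv.of Q)

namespace PathAlgebra

section
variable (k : Type w) [Field k] {Q : Type u} [Quiver.{v} Q]

instance : AddCommGroup (PathAlgebra k Q) :=
  inferInstanceAs (AddCommGroup (AllPaths Q →₀ k))

instance : Module k (PathAlgebra k Q) :=
  inferInstanceAs (Module k (AllPaths Q →₀ k))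

/-- The basis element given by a path. -/
def ofPath (p : AllPaths Q) : PathAlgebra k Q := Finsupp.single p 1

open Classical in
/-- The product `q p` of two paths in `kQ`: the concatenation "first `p`, then `q`" if `p` ends
where `q` starts, and `0` otherwise. -/
def pathMul (q p : AllPaths Q) : PathAlgebra k Q :=
  if h : p.tgt = q.src then ofPath k ⟨p.src, q.tgt, (p.path.cast rfl h).comp q.path⟩ else 0

variable {k} in
theorem pathMul_of {a b c : Q} (q : Quiver.Path b c) (p : Quiver.Path a b) :
    pathMul k ⟨b, c, q⟩ ⟨a, b, p⟩ = ofPath k ⟨a, c, p.comp q⟩ := by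
  simp [pathMul]

variable {k} in
theorem pathMul_ne {q p : AllPaths Q} (h : p.tgt ≠ q.src) : pathMul k q p = 0 := by
  simp [pathMul, h]

/-- The multiplication of `kQ`: the bilinear extension of the product of paths. -/
def mulBilin : PathAlgebra k Q →ₗ[k] PathAlgebra k Q →ₗ[k] PathAlgebra k Q :=
  Finsupp.linearCombination k fun q =>
    (Finsupp.linearCombination k (pathMul k q) : (AllPaths Q →₀ k) →ₗ[k] PathAlgebra k Q)

instance : Mul (PathAlgebra k Q) := ⟨fun x y => mulBilin k x y⟩

/-- The identity of `kQ`: the sum of the trivial paths `e_a`. -/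
instance [Fintype Q] : One (PathAlgebra k Q) := ⟨∑ a : Q, ofPath k ⟨a, a, Quiver.Path.nil⟩⟩

variable {k}

theorem mul_def (x y : PathAlgebra k Q) : x * y = mulBilin k x y := rfl

theorem one_def [Fintype Q] :
    (1 : PathAlgebra k Q) = ∑ a : Q, ofPath k ⟨a, a, Quiver.Path.nil⟩ := rfl

theorem ofPath_mul (q p : AllPaths Q) : ofPath k q * ofPath k p = pathMul k q p := by
  have h1 : mulBilin k (ofPath k q) =
      (Finsupp.linearCombination k (pathMul k q) : (AllPaths Q →₀ k) →ₗ[k] PathAlgebra k Q) :=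
    (Finsupp.linearCombination_single k 1 q).trans (one_smul k _)
  rw [mul_def, h1]
  exact (Finsupp.linearCombination_single k 1 p).trans (one_smul k _)

theorem pathMul_assoc (r q p : AllPaths Q) :
    pathMul k r q * ofPath k p = ofPath k r * pathMul k q p := by
  obtain ⟨c', d, r⟩ := r
  obtain ⟨b', c, q⟩ := q
  obtain ⟨a, b, p⟩ := p
  by_cases h1 : c = c'
  · subst h1
    by_cases h2 : b = b'
    · subst h2
      rw [pathMul_of, pathMul_of, ofPath_mul, ofPath_mul, pathMul_of, pathMul_of,
        Quiver.Path.comp_assoc]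
    · rw [pathMul_of, ofPath_mul, pathMul_ne (by exact h2), pathMul_ne (by exact h2)]
      simp [mul_def]
  · rw [pathMul_ne (by exact h1)]
    by_cases h2 : b = b'
    · subst h2
      rw [pathMul_of, ofPath_mul, pathMul_ne (by exact h1)]
      simp [mul_def]
    · rw [pathMul_ne (by exact h2)]
      simp [mul_def]

theorem induction_on {P : PathAlgebra k Q → Prop} (x : PathAlgebra k Q) (h0 : P 0)
    (hadd : ∀ x y, P x → P y → P (x + y)) (hof : ∀ (c : k) (p : AllPaths Q), P (c • ofPath k p)) :
    P x := by
  refine Finsupp.induction_linear (motive := P) x h0 hadd fun p c => ?_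
  have := hof c p
  rwa [show c • ofPath k p = (Finsupp.single p c : AllPaths Q →₀ k) by
    exact (Finsupp.smul_single c p 1).trans (by rw [smul_eq_mul, mul_one])] at this

theorem smul_mul' (c : k) (x y : PathAlgebra k Q) : (c • x) * y = c • (x * y) := by
  simp [mul_def]

theorem mul_smul' (c : k) (x y : PathAlgebra k Q) : x * (c • y) = c • (x * y) := by
  simp [mul_def]

theorem add_mul' (x y z : PathAlgebra k Q) : (x + y) * z = x * z + y * z := by
  simp [mul_def]

theorem mul_add' (x y z : PathAlgebra k Q) : x * (y + z) = x * y + x * z := by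
  simp [mul_def]

theorem zero_mul' (x : PathAlgebra k Q) : 0 * x = 0 := by simp [mul_def]

theorem mul_zero' (x : PathAlgebra k Q) : x * 0 = 0 := by simp [mul_def]

theorem mul_assoc' (x y z : PathAlgebra k Q) : x * y * z = x * (y * z) := by
  induction x using induction_on with
  | h0 => simp only [zero_mul']
  | hadd x x' h h' => simp only [add_mul', h, h']
  | hof c r =>
    induction y using induction_on with
    | h0 => simp only [zero_mul', mul_zero']
    | hadd x x' h h' => simp only [add_mul', mul_add', h, h']
    | hof d q =>
      induction z using induction_on with
      | h0 => simp only [mul_zero']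
      | hadd x x' h h' => simp only [mul_add', h, h']
      | hof e p => simp only [smul_mul', mul_smul', ofPath_mul, pathMul_assoc]

variable [Fintype Q]

theorem one_mul' (x : PathAlgebra k Q) : 1 * x = x := by
  induction x using induction_on with
  | h0 => simp only [mul_zero']
  | hadd x x' h h' => simp only [mul_add', h, h']
  | hof c p =>
    obtain ⟨a, b, p⟩ := p
    rw [mul_smul', one_def, mul_def, map_sum, LinearMap.sum_apply]
    simp only [← mul_def, ofPath_mul]
    rw [Finset.sum_eq_single b]
    · rw [pathMul_of]; rfl
    · intro d _ hd
      exact pathMul_ne (by exact hd.symm)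
    · simp

theorem mul_one' (x : PathAlgebra k Q) : x * 1 = x := by
  induction x using induction_on with
  | h0 => simp only [zero_mul']
  | hadd x x' h h' => simp only [add_mul', h, h']
  | hof c p =>
    obtain ⟨a, b, p⟩ := p
    rw [smul_mul', one_def, mul_def, map_sum]
    simp only [← mul_def, ofPath_mul]
    rw [Finset.sum_eq_single a]
    · rw [pathMul_of, Quiver.Path.nil_comp]
    · intro d _ hd
      exact pathMul_ne (by exact hd)
    · simp

instance : Ring (PathAlgebra k Q) where
  __ := instAddCommGroup k
  __ := instMul k
  __ := instOneOfFintype k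
  left_distrib := mul_add'
  right_distrib := add_mul'
  zero_mul := zero_mul'
  mul_zero := mul_zero'
  mul_assoc := mul_assoc'
  one_mul := one_mul'
  mul_one := mul_one'

instance : Algebra k (PathAlgebra k Q) := Algebra.ofModule smul_mul' mul_smul'

end

section
variable {k : Type w} [Field k] {Q : Type u} [Quiver.{v} Q]

/-- The morphism of quivers underlying a quiver automorphism. -/
def autPrefunctor (g : QuiverAut Q) : Q ⥤q Q := Prefunctor.ofQuivHom g.hom

theorem autPrefunctor_injective (g : QuiverAut Q) : Function.Injective (autPrefunctor g).obj :=
  (Quiv.equivOfIso g).injective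

theorem autPrefunctor_bijective (g : QuiverAut Q) : Function.Bijective (autPrefunctor g).obj :=
  (Quiv.equivOfIso g).bijective

/-- A quiver automorphism acts on paths, by acting on the vertices and arrows of the path. -/
instance : MulAction (QuiverAut Q) (AllPaths Q) where
  smul g p := ⟨_, _, (autPrefunctor g).mapPath p.path⟩
  one_smul p := by
    obtain ⟨a, b, p⟩ := p
    have := Prefunctor.mapPath_id p
    exact congrArg (fun q => (⟨a, b, q⟩ : AllPaths Q)) this
  mul_smul g h p := by
    obtain ⟨a, b, p⟩ := p
    have := Prefunctor.mapPath_comp_apply (autPrefunctor h)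
      (autPrefunctor g) p
    exact congrArg (fun q => (⟨_, _, q⟩ : AllPaths Q)) this

theorem smul_mk (g : QuiverAut Q) {a b : Q} (p : Quiver.Path a b) :
    g • (⟨a, b, p⟩ : AllPaths Q) = ⟨_, _, (autPrefunctor g).mapPath p⟩ := rfl

/-- The linear extension to `kQ` of the action of a quiver automorphism on paths. -/
def autMap (g : QuiverAut Q) : PathAlgebra k Q →ₗ[k] PathAlgebra k Q :=
  Finsupp.lmapDomain k k (g • ·)

instance : SMul (QuiverAut Q) (PathAlgebra k Q) := ⟨fun g x => autMap g x⟩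

theorem smul_def (g : QuiverAut Q) (x : PathAlgebra k Q) : g • x = autMap g x := rfl

theorem smul_ofPath (g : QuiverAut Q) (p : AllPaths Q) :
    g • ofPath k p = ofPath k (g • p) := by
  rw [smul_def]
  exact Finsupp.mapDomain_single

theorem smul_pathMul (g : QuiverAut Q) (q p : AllPaths Q) :
    g • pathMul k q p = pathMul k (g • q) (g • p) := by
  obtain ⟨b', c, q⟩ := q
  obtain ⟨a, b, p⟩ := p
  by_cases h : b = b'
  · subst h
    rw [pathMul_of, smul_ofPath, smul_mk, smul_mk, smul_mk, pathMul_of, Prefunctor.mapPath_comp]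
  · rw [pathMul_ne (by exact h), smul_mk, smul_mk, pathMul_ne, smul_def, map_zero]
    exact fun h' => h (autPrefunctor_injective g h')

/-- The automorphism group of `Q` acts on `kQ` by algebra automorphisms. -/
instance [Fintype Q] : MulSemiringAction (QuiverAut Q) (PathAlgebra k Q) where
  one_smul x := by
    induction x using induction_on with
    | h0 => simp [smul_def]
    | hadd x y hx hy => simpa [smul_def] using congrArg₂ (· + ·) hx hy
    | hof c p => rw [smul_def, map_smul, ← smul_def, smul_ofPath, one_smul]
  mul_smul g h x := by
    induction x using induction_on with
    | h0 => simp [smul_def]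
    | hadd x y hx hy => simpa [smul_def] using congrArg₂ (· + ·) hx hy
    | hof c p =>
      simp only [smul_def, map_smul]
      simp only [← smul_def, smul_ofPath, mul_smul]
  smul_zero g := by simp [smul_def]
  smul_add g x y := by simp [smul_def]
  smul_one g := by
    rw [one_def, smul_def, map_sum]
    simp only [← smul_def, smul_ofPath]
    exact Fintype.sum_bijective _ (autPrefunctor_bijective g) _ _ fun a => rfl
  smul_mul g x y := by
    induction x using induction_on with
    | h0 => simp [smul_def]
    | hadd x x' h h' => simpa [smul_def, add_mul] using congrArg₂ (· + ·) h h'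
    | hof c q =>
      induction y using induction_on with
      | h0 => simp [smul_def]
      | hadd y y' h h' => simpa [smul_def, mul_add] using congrArg₂ (· + ·) h h'
      | hof d p =>
        simp only [smul_def, map_smul, smul_mul_assoc, mul_smul_comm, ofPath_mul]
        simp only [← smul_def, smul_ofPath, smul_pathMul, ofPath_mul]

instance [Fintype Q] : SMulCommClass (QuiverAut Q) k (PathAlgebra k Q) :=
  ⟨fun g c x => by simp [smul_def]⟩

end
end PathAlgebra

/-! ### Modules -/

/-- A nonzero module that is not the direct sum of two nonzero submodules. -/
def IsIndecomposableModule (R : Type*) [Ring R] (M : Type*) [AddCommGroup M] [Module R M] : Prop :=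
  Nontrivial M ∧ ∀ N P : Submodule R M, IsCompl N P → N = ⊥ ∨ P = ⊥

/-- The restriction of an `S`-module `M` along a ring homomorphism `f : R → S`. -/
def Restrict {R S : Type*} [Ring R] [Ring S] (_f : R →+* S) (M : Type*) : Type _ := M

namespace Restrict
variable {R S : Type*} [Ring R] [Ring S] (f : R →+* S) (M : Type*) [AddCommGroup M] [Module S M]

instance : AddCommGroup (Restrict f M) := inferInstanceAs (AddCommGroup M)

instance : Module R (Restrict f M) := Module.compHom M f

end Restrict

/-- The induced `S`-module `S ⊗_R M` of an `R`-module `M` along a homomorphism `f : R → S` of (not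
necessarily commutative) rings: the quotient of `S ⊗_ℤ M` by the relations
`s f(a) ⊗ x = s ⊗ a x`. (These relations are stable under left multiplication by `S`, so that the
`S`-submodule spanned by them is the additive subgroup generated by them.) -/
def Induced {R S : Type*} [Ring R] [Ring S] (f : R →+* S) (M : Type*) [AddCommGroup M]
    [Module R M] : Type _ :=
  (S ⊗[ℤ] M) ⧸ Submodule.span S
    {z : S ⊗[ℤ] M | ∃ (s : S) (a : R) (x : M), z = (s * f a) ⊗ₜ[ℤ] x - s ⊗ₜ[ℤ] (a • x)}

namespace Induced
variable {R S : Type*} [Ring R] [Ring S] (f : R →+* S) (M : Type*) [AddCommGroup M] [Module R M]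

instance : AddCommGroup (Induced f M) :=
  inferInstanceAs (AddCommGroup ((S ⊗[ℤ] M) ⧸ Submodule.span S
    {z : S ⊗[ℤ] M | ∃ (s : S) (a : R) (x : M), z = (s * f a) ⊗ₜ[ℤ] x - s ⊗ₜ[ℤ] (a • x)}))

instance : Module S (Induced f M) :=
  inferInstanceAs (Module S ((S ⊗[ℤ] M) ⧸ Submodule.span S
    {z : S ⊗[ℤ] M | ∃ (s : S) (a : R) (x : M), z = (s * f a) ⊗ₜ[ℤ] x - s ⊗ₜ[ℤ] (a • x)}))

end Induced

/-- For a group `G` acting on a ring `A`, `g : G` and an `A`-module `X`: the twisted `A`-module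
`ᵍX`, with the same underlying additive group and the new action `a · x = g⁻¹(a) x`. -/
def Twist {G : Type*} (_g : G) (X : Type*) : Type _ := X

namespace Twist
variable {G : Type*} [Group G] (g : G) (X : Type*) [AddCommGroup X]

instance : AddCommGroup (Twist g X) := inferInstanceAs (AddCommGroup X)

instance {A : Type*} [Ring A] [MulSemiringAction G A] [Module A X] : Module A (Twist g X) :=
  Module.compHom X (MulSemiringAction.toRingHom G A g⁻¹)

variable {X}

/-- The identity map `X → ᵍX`. -/
def of : X ≃+ Twist g X := AddEquiv.refl X

theorem smul_of {A : Type*} [Ring A] [MulSemiringAction G A] [Module A X] (a : A) (x : X) :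
    a • of g x = of g ((g⁻¹ • a) • x) := rfl

end Twist

/-! ### Skew group algebras of cyclic groups and their modules

`SkewMonoidAlgebra A G` is the skew group algebra `A # kG`, with `single g a` being `a # g`. -/

/-- The subgroup generated by `τ ^ m`, inside the one generated by `τ`. -/
theorem zpowers_pow_le {G : Type*} [Group G] (τ : G) (m : ℕ) :
    Subgroup.zpowers (τ ^ m) ≤ Subgroup.zpowers τ :=
  Subgroup.zpowers_le.2 (Subgroup.npow_mem_zpowers τ m)

section Skew
variable {G : Type*} [Group G]

/-- The embedding `A → A # k⟨τ⟩`, `a ↦ a # 1`. -/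
def baseHom (A : Type*) [Ring A] [MulSemiringAction G A] (τ : G) :
    A →+* SkewMonoidAlgebra A (Subgroup.zpowers τ) :=
  SkewMonoidAlgebra.singleOneRingHom

/-- The embedding `A # k⟨τ ^ m⟩ → A # k⟨τ⟩`, `a # g ↦ a # g`. -/
def powHom (A : Type*) [Ring A] [MulSemiringAction G A] (τ : G) (m : ℕ) :
    SkewMonoidAlgebra A (Subgroup.zpowers (τ ^ m)) →+* SkewMonoidAlgebra A (Subgroup.zpowers τ) :=
  SkewMonoidAlgebra.mapDomainRingHom (f := Subgroup.inclusion (zpowers_pow_le τ m))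
    fun _ _ => rfl

variable {k : Type*} [Field k]

/-- The representation of `⟨τ⟩` in which `τ` acts by `f`, where `f ^ (orderOf τ) = 1`. -/
def cyclicRep (τ : G) {V : Type*} [AddCommGroup V] [Module k V] (f : V ≃ₗ[k] V)
    (hf : f ^ orderOf τ = 1) : Representation k (Subgroup.zpowers τ) V :=
  LinearEquiv.automorphismGroup.toLinearMapMonoidHom.comp
    (monoidHomOfForallMemZpowers (g := (⟨τ, Subgroup.mem_zpowers τ⟩ : Subgroup.zpowers τ)) (g' := f)
      (by rintro ⟨_, j, rfl⟩; exact ⟨j, Subtype.ext (by simp)⟩)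
      (by rw [Subgroup.orderOf_mk]; exact orderOf_dvd_of_pow_eq_one hf))

theorem cyclicRep_gen (τ : G) {V : Type*} [AddCommGroup V] [Module k V] (f : V ≃ₗ[k] V)
    (hf : f ^ orderOf τ = 1) (v : V) :
    cyclicRep τ f hf ⟨τ, Subgroup.mem_zpowers τ⟩ v = f v := by
  change (monoidHomOfForallMemZpowers (g' := f) _ _
    (⟨τ, Subgroup.mem_zpowers τ⟩ : Subgroup.zpowers τ)) v = _
  rw [monoidHomOfForallMemZpowers_apply_gen]

/-- The one-dimensional representation `L_i = k` of `⟨τ⟩` on which `τ` acts as multiplication by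
`ζ ^ i`, where `ζ` is a primitive root of unity of order `orderOf τ`. -/
def powerRep (τ : G) {ζ : kˣ} (hζ : IsPrimitiveRoot ζ (orderOf τ)) (i : ℕ) :
    Representation k (Subgroup.zpowers τ) k :=
  cyclicRep τ (DistribMulAction.toModuleAut k k (ζ ^ i)) (by
    rw [← map_pow, ← pow_mul, mul_comm, pow_mul, hζ.pow_eq_one, one_pow, map_one])

theorem powerRep_gen (τ : G) {ζ : kˣ} (hζ : IsPrimitiveRoot ζ (orderOf τ)) (i : ℕ) (c : k) :
    powerRep τ hζ i ⟨τ, Subgroup.mem_zpowers τ⟩ c = (ζ : k) ^ i * c := by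
  rw [powerRep, cyclicRep_gen]
  simp [Units.smul_def]

variable {A : Type*} [Ring A] [Algebra k A] [MulSemiringAction G A] [SMulCommClass G k A]
  {X : Type*} [AddCommGroup X] [Module k X] [Module A X] [IsScalarTower k A X]

/-- An isomorphism `φ : ^τX → X` as a `k`-linear automorphism of the vector space `X`. -/
def Twist.underlying {τ : G} (φ : Twist τ X ≃ₗ[A] X) : X ≃ₗ[k] X where
  __ := (Twist.of τ).trans φ.toAddEquiv
  map_smul' c x := by
    have h : Twist.of τ (c • x) = algebraMap k A c • Twist.of τ x := by
      rw [Twist.smul_of, smul_algebraMap, algebraMap_smul]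
    change φ (Twist.of τ (c • x)) = c • φ (Twist.of τ x)
    rw [h, map_smul, algebraMap_smul]

/-- An isomorphism `φ : ^τX → X` such that `φ ∘ ^τφ ∘ ⋯ ∘ ^{τ^{r-1}}φ`, which is the `r`-fold
iterate of the map `φ` of the set `X`, is the identity, where `r` is the order of `τ`. -/
def IsNormalizedIso {τ : G} (φ : Twist τ X ≃ₗ[A] X) : Prop :=
  ∀ x : X, (fun y : X => φ (Twist.of τ y))^[orderOf τ] x = x

theorem Twist.underlying_pow {τ : G} {φ : Twist τ X ≃ₗ[A] X} (hφ : IsNormalizedIso φ) :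
    (Twist.underlying (k := k) φ) ^ orderOf τ = 1 := by
  refine LinearEquiv.ext fun x => ?_
  have h : ∀ (n : ℕ) (y : X), ((Twist.underlying (k := k) φ) ^ n) y =
      (fun y : X => φ (Twist.of τ y))^[n] y := by
    intro n
    induction n with
    | zero => intro y; rfl
    | succ n ih => intro y; rw [pow_succ, Function.iterate_succ_apply, ← ih]; rfl
  rw [h, hφ x]
  rfl

/-- The action of `⟨τ⟩` on `X` given by a normalized isomorphism `φ : ^τX → X`: the element `τ ^ j`
acts as the map `φ ^ j` of the set `X`. -/
def isoRep (k : Type*) [Field k] {A : Type*} [Ring A] [Algebra k A] [MulSemiringAction G A]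
    [SMulCommClass G k A] {X : Type*} [AddCommGroup X] [Module k X] [Module A X]
    [IsScalarTower k A X] {τ : G} {φ : Twist τ X ≃ₗ[A] X} (hφ : IsNormalizedIso φ) :
    Representation k (Subgroup.zpowers τ) X :=
  cyclicRep τ (Twist.underlying φ) (Twist.underlying_pow hφ)

theorem isoRep_smul {τ : G} {φ : Twist τ X ≃ₗ[A] X} (hφ : IsNormalizedIso φ)
    (g : Subgroup.zpowers τ) (a : A) (x : X) :
    isoRep k hφ g (a • x) = (g • a) • isoRep k hφ g x := by
  set ρ := isoRep k hφ
  set t : Subgroup.zpowers τ := ⟨τ, Subgroup.mem_zpowers τ⟩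
  have h1 : ∀ (a : A) (x : X), ρ t (a • x) = (t • a) • ρ t x := by
    intro a x
    have e : ∀ y, ρ t y = φ (Twist.of τ y) := fun y => cyclicRep_gen τ _ _ y
    rw [e, e, ← map_smul, Twist.smul_of]
    congr 3
    exact (inv_smul_smul τ a).symm
  have hinv : ∀ y, ρ t (ρ t⁻¹ y) = y := fun y => by
    rw [← Module.End.mul_apply, ← map_mul, mul_inv_cancel, map_one, Module.End.one_apply]
  have hinv' : ∀ y, ρ t⁻¹ (ρ t y) = y := fun y => by
    rw [← Module.End.mul_apply, ← map_mul, inv_mul_cancel, map_one, Module.End.one_apply]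
  have h2 : ∀ (a : A) (x : X), ρ t⁻¹ (a • x) = (t⁻¹ • a) • ρ t⁻¹ x := by
    intro a x
    rw [← hinv' ((t⁻¹ • a) • ρ t⁻¹ x), h1, hinv, smul_inv_smul]
  obtain ⟨j, rfl⟩ : ∃ j : ℤ, t ^ j = g := by
    obtain ⟨_, j, rfl⟩ := g
    exact ⟨j, Subtype.ext (by simp [t])⟩
  induction j generalizing a x with
  | zero => simp
  | succ n ih =>
    rw [zpow_add_one, map_mul, Module.End.mul_apply, h1, ih, mul_smul, Module.End.mul_apply]
  | pred n ih =>
    rw [zpow_sub_one, map_mul, Module.End.mul_apply, h2, ih, mul_smul, Module.End.mul_apply]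

section tensor
variable {H : Type*} [Group H] [MulSemiringAction H A]
  {V : Type*} [AddCommGroup V] [Module k V]

/-- The action of the skew group algebra `A # kH` on `V ⊗ X`, where `V` is a `kH`-module and `X` an
`(A # kH)`-module, the latter given by an `A`-module structure and a compatible action `ρX` of `H`:
the element `a # g` sends `v ⊗ x` to `(g v) ⊗ (a (g x))`. -/
def skewTensorHom (ρV : Representation k H V) (ρX : Representation k H X)
    (h : ∀ (g : H) (a : A) (x : X), ρX g (a • x) = (g • a) • ρX g x) :
    SkewMonoidAlgebra A H →+* Module.End k (V ⊗[k] X) :=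
  SkewMonoidAlgebra.liftNCRingHom
    (((Module.End.lTensorAlgHom k X V).comp (Algebra.lsmul k k X : A →ₐ[k] Module.End k X)) :
      A →+* Module.End k (V ⊗[k] X))
    (ρV.tprod ρX) (by
      intro a g
      refine TensorProduct.ext' fun v x => ?_
      exact congrArg (fun y => ρV g v ⊗ₜ[k] y) (h g a x).symm)

theorem skewTensorHom_single (ρV : Representation k H V) (ρX : Representation k H X)
    (h : ∀ (g : H) (a : A) (x : X), ρX g (a • x) = (g • a) • ρX g x)
    (g : H) (a : A) (v : V) (x : X) :
    skewTensorHom ρV ρX h (SkewMonoidAlgebra.single g a) (v ⊗ₜ[k] x) =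
      ρV g v ⊗ₜ[k] (a • ρX g x) := by
  exact congrArg (fun F : Module.End k (V ⊗[k] X) => F (v ⊗ₜ[k] x))
    (SkewMonoidAlgebra.liftNC_single
      (((Module.End.lTensorAlgHom k X V).comp (Algebra.lsmul k k X : A →ₐ[k] Module.End k X)) :
        A →+ Module.End k (V ⊗[k] X)) (ρV.tprod ρX) g a)

/-- The `(A # kH)`-module `V ⊗ X`, with the action of `skewTensorHom`. -/
def SkewTensor (_ρV : Representation k H V) (ρX : Representation k H X)
    (_h : ∀ (g : H) (a : A) (x : X), ρX g (a • x) = (g • a) • ρX g x) : Type _ := V ⊗[k] X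

instance (ρV : Representation k H V) (ρX : Representation k H X)
    (h : ∀ (g : H) (a : A) (x : X), ρX g (a • x) = (g • a) • ρX g x) :
    AddCommGroup (SkewTensor ρV ρX h) :=
  inferInstanceAs (AddCommGroup (V ⊗[k] X))

instance (ρV : Representation k H V) (ρX : Representation k H X)
    (h : ∀ (g : H) (a : A) (x : X), ρX g (a • x) = (g • a) • ρX g x) :
    Module (SkewMonoidAlgebra A H) (SkewTensor ρV ρX h) :=
  Module.compHom (V ⊗[k] X) (skewTensorHom ρV ρX h)

end tensor

/-- The `(A # k⟨τ⟩)`-module `L_i ⊗ X`, where `X` carries the `(A # k⟨τ⟩)`-module structure defined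
by a normalized isomorphism `φ : ^τX → X`, so that
`(a # τ ^ j) (c ⊗ x) = ζ ^ (i * j) c ⊗ a φ ^ j (x)`. -/
abbrev CharTensor {τ : G} {ζ : kˣ} (hζ : IsPrimitiveRoot ζ (orderOf τ))
    {φ : Twist τ X ≃ₗ[A] X} (hφ : IsNormalizedIso φ) (i : ℕ) : Type _ :=
  SkewTensor (powerRep τ hζ i) (isoRep k hφ) (isoRep_smul hφ)

end Skew

/-- The skew group algebra `kQ # k⟨τ⟩` of a quiver automorphism `τ`. -/
abbrev SkewPathAlgebra (k : Type w) [Field k] {Q : Type u} [Quiver.{v} Q] [Fintype Q]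
    (τ : QuiverAut Q) : Type _ :=
  SkewMonoidAlgebra (PathAlgebra k Q) (Subgroup.zpowers τ)

section
variable {k : Type w} [Field k] {Q : Type u} [Quiver.{v} Q] [Fintype Q] (σ : QuiverAut Q)
  {X : Type x} [AddCommGroup X] [Module (PathAlgebra k Q) X]

/-- The `kQ # k⟨σ⟩`-module `(kQ # k⟨σ⟩) ⊗ (L_i ⊗ X)`, where the outer tensor product is taken over
`kQ # k⟨σ ^ m⟩`. -/
abbrev InducedCharTensor [Module k X] [IsScalarTower k (PathAlgebra k Q) X] (m : ℕ)
    {ζ : kˣ} (hζ : IsPrimitiveRoot ζ (orderOf (σ ^ m)))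
    {φ : Twist (σ ^ m) X ≃ₗ[PathAlgebra k Q] X} (hφ : IsNormalizedIso φ) (i : ℕ) : Type _ :=
  Induced (powHom (PathAlgebra k Q) σ m) (CharTensor hζ hφ i)

variable (X) in
/-- The `kQ`-module `X ⊕ ^σX ⊕ ⋯ ⊕ ^{σ^{m-1}}X`. -/
abbrev TwistSum (m : ℕ) : Type _ := ⨁ j : Fin m, Twist (σ ^ (j : ℕ)) X

end

end

/-!
The argument takes place over any `k`-algebra `A` on which a group acts, with a finite-dimensional
indecomposable module `X`. Only the finite dimension of `kQ` uses the quiver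
(`PathAlgebra.finite_of_acyclic`): a finite quiver without oriented cycles has finitely many paths.

By Fitting's lemma, every endomorphism of `X` is a scalar plus a nilpotent one. In particular, `End X`
is local, and the `r`-th iterate of an isomorphism `^{σ^m}X ≅ X` has an inverse `r`-th root among the
polynomials in it, by Newton's method; this gives a normalized isomorphism
(`exists_isNormalizedIso`).

The ring `S = A # k⟨σ⟩` is free as a right module over `A # k⟨σ ^ m⟩`, with basis the `σ ^ j`, `j < m`
(`Induced.bijective_sum_skewGen_pow`). Hence `M_i` restricts to `X ⊕ ^σX ⊕ ⋯` over `A`, and an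
`S`-homomorphism `M_i → Y` is the same as an `A`-homomorphism `h : X → Y` with
`σ ^ m h = h (ζ ^ i φ)`. As `r` is invertible in `k`, every `A`-homomorphism `h : X → Y` is the sum of
its components in the eigenspaces of `h ↦ σ ^ m h φ⁻¹` (`sum_eigenComponent`). Applied to the
universal map to the module induced from `X`, this splits that module into the sum of the `M_i`
(`IndCharTensor.nonempty_induced_linearEquiv`).

If `X` is a direct summand of `Y` over `A`, via `h : X → Y`, then one of the eigencomponents of `h` is
a split monomorphism too, because `End X` is local. The corresponding `S`-homomorphism `M_i → Y` is
injective, because the twists `^{σ^j}X`, `j < m`, are pairwise non-isomorphic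
(`exists_injective_of_isUnit`). If `Y` restricts to the sum of the twists, it follows by finite
length that `Y ≅ M_i`. If `M_i = N ⊕ P`, then `X` is a summand of `N` or of `P`, so that this
submodule contains an `M_l`, and again by finite length it is all of `M_i`.

An isomorphism `M_i ≅ M_j` gives an automorphism `g` of `X` with `g (ζ ^ i φ) = (ζ ^ j φ) g`. Since
`g` has only one eigenvalue, this forces `ζ ^ i = ζ ^ j`
(`IndCharTensor.pow_eq_pow_of_intertwines`).
-/

noncomputable section

/-! ### Local endomorphism rings -/

theorem IsLocalRing.isUnit_or_isUnit_of_isUnit_sum {R : Type*} [Ring R] [IsLocalRing R] {a b : R}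
    (h : IsUnit (a + b)) : IsUnit a ∨ IsUnit b := by
  obtain ⟨u, hu⟩ := h
  have h1 : (↑u⁻¹ : R) * a + ↑u⁻¹ * b = 1 := by rw [← mul_add, ← hu, Units.inv_mul]
  simpa using IsLocalRing.isUnit_or_isUnit_of_add_one h1

theorem IsLocalRing.exists_isUnit_of_isUnit_finset_sum {R : Type*} [Ring R] [IsLocalRing R]
    {ι : Type*} (s : Finset ι) (f : ι → R) (h : IsUnit (∑ i ∈ s, f i)) :
    ∃ i ∈ s, IsUnit (f i) := by
  classical
  induction s using Finset.induction_on with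
  | empty => simp at h
  | insert a s ha ih =>
    rw [Finset.sum_insert ha] at h
    rcases isUnit_or_isUnit_of_isUnit_sum h with h | h
    · exact ⟨a, by simp, h⟩
    · obtain ⟨i, hi, hu⟩ := ih h
      exact ⟨i, by simp [hi], hu⟩

section
variable {R : Type*} [Ring R]

/-- Fitting's lemma for an indecomposable module of finite length. -/
theorem IsIndecomposableModule.isUnit_or_isNilpotent {M : Type*} [AddCommGroup M] [Module R M]
    [IsArtinian R M] [IsNoetherian R M] (hM : IsIndecomposableModule R M) (f : Module.End R M) :
    IsUnit f ∨ IsNilpotent f := by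
  obtain ⟨n, hn⟩ := Filter.eventually_atTop.1 (LinearMap.eventually_isCompl_ker_pow_range_pow f)
  have h := hn (n + 1) (by omega)
  rcases hM.2 _ _ h with h0 | h0
  · left
    rw [Module.End.isUnit_iff]
    apply IsArtinian.bijective_of_injective_endomorphism
    have hi : Function.Injective (f ^ (n + 1)) := LinearMap.ker_eq_bot.1 h0
    rw [pow_succ] at hi
    exact Function.Injective.of_comp (f := (f ^ n : Module.End R M)) hi
  · right
    exact ⟨n + 1, LinearMap.range_eq_bot.1 h0⟩

theorem IsIndecomposableModule.isLocalRing_end {M : Type*} [AddCommGroup M] [Module R M]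
    [IsArtinian R M] [IsNoetherian R M] (hM : IsIndecomposableModule R M) :
    IsLocalRing (Module.End R M) := by
  have := hM.1
  refine ⟨fun {a b} h => ?_⟩
  rcases hM.isUnit_or_isNilpotent a with ha | ha
  · exact Or.inl ha
  · right
    rw [eq_sub_of_add_eq' h]
    exact ha.isUnit_one_sub

theorem IsLocalRing.eq_zero_or_eq_one_of_mul_self_eq {E : Type*} [Ring E] [IsLocalRing E] {e : E}
    (he : e * e = e) : e = 0 ∨ e = 1 := by
  rcases IsLocalRing.isUnit_or_isUnit_of_add_one (add_sub_cancel e 1) with h | h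
  · right
    exact h.mul_left_cancel (by rw [he, mul_one])
  · left
    refine h.mul_left_cancel ?_
    rw [sub_mul, he, one_mul, sub_self, mul_zero]

/-- An automorphism of an indecomposable module cannot factor through an indecomposable module
that is not isomorphic to it. -/
theorem not_isUnit_comp_of_isEmpty_linearEquiv {M N : Type*} [AddCommGroup M] [Module R M]
    [AddCommGroup N] [Module R N] [IsLocalRing (Module.End R M)] [IsLocalRing (Module.End R N)]
    (hMN : IsEmpty (M ≃ₗ[R] N)) (f : M →ₗ[R] N) (g : N →ₗ[R] M) :
    ¬ IsUnit (g ∘ₗ f : Module.End R M) := by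
  rintro ⟨w, hw⟩
  set u : Module.End R M := ↑w⁻¹
  have h1 : u ∘ₗ g ∘ₗ f = LinearMap.id := by
    rw [← hw]; exact w.inv_mul
  let e : Module.End R N := f ∘ₗ u ∘ₗ g
  have he : e * e = e := by
    refine LinearMap.ext fun x => ?_
    exact congrArg f (LinearMap.congr_fun h1 (u (g x)))
  rcases IsLocalRing.eq_zero_or_eq_one_of_mul_self_eq he with h0 | h0
  · apply one_ne_zero (α := Module.End R M)
    refine LinearMap.ext fun x => ?_
    have h2 : ∀ x, u (g (f x)) = x := fun x => LinearMap.congr_fun h1 x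
    have h3 : f (u (g (f x))) = 0 := LinearMap.congr_fun h0 (f x)
    have h4 := h2 x
    rw [h2] at h3
    rw [h3, map_zero, map_zero] at h4
    exact h4.symm
  · exact hMN.elim (LinearEquiv.ofLinearMap f (u ∘ₗ g) h0 h1)

/-- If `M j → Y` are split monomorphisms from pairwise non-isomorphic modules with local endomorphism
rings, then their sum is injective: this is Gaussian elimination with the diagonal entries of the
matrix `π i ∘ ι j` as pivots, since the off-diagonal entries only change them by non-units. -/
theorem eq_zero_of_sum_split_eq_zero {J : Type*} {M : J → Type*} [∀ j, AddCommGroup (M j)]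
    [∀ j, Module R (M j)] [∀ j, IsLocalRing (Module.End R (M j))]
    (hM : ∀ i j, i ≠ j → IsEmpty (M i ≃ₗ[R] M j)) {Y : Type*} [AddCommGroup Y] [Module R Y]
    (s : Finset J) (ι : ∀ j, M j →ₗ[R] Y) (π : ∀ j, Y →ₗ[R] M j)
    (hπ : ∀ j ∈ s, IsUnit (π j ∘ₗ ι j : Module.End R (M j))) (z : ∀ j, M j)
    (hz : ∑ j ∈ s, ι j (z j) = 0) : ∀ j ∈ s, z j = 0 := by
  classical
  induction s using Finset.induction_on generalizing ι with
  | empty => simp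
  | insert a s ha ih =>
    obtain ⟨w, hw⟩ := hπ a (by simp)
    have hw1 : ∀ x, (↑w⁻¹ : Module.End R (M a)) (π a (ι a x)) = x := fun x => by
      have := LinearMap.congr_fun w.inv_mul x
      rwa [hw] at this
    let p : Y →ₗ[R] Y := ι a ∘ₗ (↑w⁻¹ : Module.End R (M a)) ∘ₗ π a
    have hs : ∀ j ∈ s, z j = 0 := by
      refine ih (fun j => ι j - p ∘ₗ ι j) (fun j hj => ?_) ?_
      · have hne : j ≠ a := fun h => ha (h ▸ hj)
        have h1 : IsUnit ((π j ∘ₗ (ι j - p ∘ₗ ι j)) +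
            ((π j ∘ₗ ι a) ∘ₗ ((↑w⁻¹ : Module.End R (M a)) ∘ₗ π a ∘ₗ ι j)) :
              Module.End R (M j)) := by
          convert hπ j (by simp [hj]) using 1
          ext x
          simp [p]
        exact (IsLocalRing.isUnit_or_isUnit_of_isUnit_sum h1).resolve_right
          (not_isUnit_comp_of_isEmpty_linearEquiv (hM j a hne) _ _)
      · have h1 : ∑ j ∈ s, ι j (z j) = - ι a (z a) := by
          rw [Finset.sum_insert ha] at hz
          exact eq_neg_of_add_eq_zero_right hz
        have h2 : ∑ j ∈ s, (ι j - p ∘ₗ ι j) (z j) =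
            (∑ j ∈ s, ι j (z j)) - p (∑ j ∈ s, ι j (z j)) := by
          simp [map_sum, Finset.sum_sub_distrib]
        rw [h2, h1]
        simp [p, hw1]
    intro j hj
    rcases Finset.mem_insert.1 hj with rfl | hj
    · rw [Finset.sum_insert ha, Finset.sum_eq_zero (fun i hi => by rw [hs i hi, map_zero]),
        add_zero] at hz
      rw [← hw1 (z j), hz, map_zero, map_zero]
    · exact hs j hj

end

section
variable {k : Type*} [Field k] [IsAlgClosed k] {A : Type*} [Ring A] [Algebra k A]
  {X : Type*} [AddCommGroup X] [Module k X] [Module A X] [IsScalarTower k A X]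

/-- Over an algebraically closed field, an endomorphism of a finite-dimensional indecomposable
module is the sum of a scalar and a nilpotent endomorphism. -/
theorem IsIndecomposableModule.exists_isNilpotent_sub [FiniteDimensional k X]
    (hX : IsIndecomposableModule A X) (g : Module.End A X) :
    ∃ c : k, IsNilpotent (g - algebraMap k (Module.End A X) c) := by
  have := hX.1
  have : IsArtinian A X := isArtinian_of_tower k inferInstance
  have : IsNoetherian A X := isNoetherian_of_tower k inferInstance
  obtain ⟨c, hc⟩ := Module.End.exists_eigenvalue (g.restrictScalars k)
  refine ⟨c, (hX.isUnit_or_isNilpotent _).resolve_left fun h => ?_⟩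
  obtain ⟨x, hx⟩ := hc.exists_hasEigenvector
  rw [Module.End.isUnit_iff] at h
  refine hx.2 (h.1 ?_)
  have hgx : g x = c • x := hx.apply_eq_smul
  rw [map_zero, LinearMap.sub_apply, hgx, Module.algebraMap_end_apply, sub_self]

end

/-! ### Path algebras of finite acyclic quivers -/

/-- A finite quiver without oriented cycles has finitely many paths: the relation "there is a path
of positive length from `a` to `b`" is well-founded, and a path ending at `b` is trivial or a path
to a smaller vertex followed by an arrow. -/
theorem AllPaths.finite_of_acyclic {Q : Type u} [Quiver.{v} Q] [Finite Q]
    [∀ a b : Q, Finite (a ⟶ b)] (hacyc : ∀ (a : Q) (p : Quiver.Path a a), p.length = 0) :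
    Finite (AllPaths Q) := by
  let r : Q → Q → Prop := fun a b => ∃ p : Quiver.Path a b, 0 < p.length
  have : IsTrans Q r := ⟨fun a b c ⟨p, hp⟩ ⟨q, _⟩ => ⟨p.comp q, by
    rw [Quiver.Path.length_comp]; omega⟩⟩
  have : Std.Irrefl r := ⟨fun a ⟨p, hp⟩ => by rw [hacyc a p] at hp; omega⟩
  have hwf : WellFounded r := Finite.wellFounded_of_trans_of_irrefl r
  have hfin : ∀ b : Q, Finite (Σ a : Q, Quiver.Path a b) := by
    intro b
    induction b using hwf.induction with
    | _ b ih =>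
      have : ∀ c : Q, Finite ((c ⟶ b) × Σ a : Q, Quiver.Path a c) := by
        intro c
        rcases isEmpty_or_nonempty (c ⟶ b) with h | ⟨⟨e⟩⟩
        · infer_instance
        · have := ih c ⟨e.toPath, by simp⟩
          infer_instance
      refine Finite.of_surjective (fun o : Option (Σ c : Q, (c ⟶ b) × Σ a : Q, Quiver.Path a c) =>
        (match o with
        | none => ⟨b, Quiver.Path.nil⟩
        | some ⟨_, e, a, p⟩ => ⟨a, p.cons e⟩ : Σ a : Q, Quiver.Path a b)) ?_
      rintro ⟨a, p⟩
      cases p with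
      | nil => exact ⟨none, rfl⟩
      | cons p e => exact ⟨some ⟨_, e, a, p⟩, rfl⟩
  refine Finite.of_surjective (fun z : Σ b : Q, Σ a : Q, Quiver.Path a b =>
    (⟨z.2.1, z.1, z.2.2⟩ : AllPaths Q)) ?_
  rintro ⟨a, b, p⟩
  exact ⟨⟨b, a, p⟩, rfl⟩

theorem PathAlgebra.finite_of_acyclic (k : Type w) [Field k] {Q : Type u} [Quiver.{v} Q] [Finite Q]
    [∀ a b : Q, Finite (a ⟶ b)] (hacyc : ∀ (a : Q) (p : Quiver.Path a a), p.length = 0) :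
    Module.Finite k (PathAlgebra k Q) := by
  have := AllPaths.finite_of_acyclic hacyc
  exact inferInstanceAs (Module.Finite k (AllPaths Q →₀ k))

/-! ### Twists of modules -/

section
variable {G : Type*} [Group G] {A : Type*} [Ring A] [MulSemiringAction G A]
  {X : Type*} [AddCommGroup X] [Module A X]

/-- An isomorphism `ᵍX ≅ ʰX` is an additive bijection of `X` that is semilinear with respect to
`h⁻¹ g`. -/
theorem Twist.nonempty_linearEquiv_iff (g h : G) :
    Nonempty (Twist g X ≃ₗ[A] Twist h X) ↔
      ∃ f : X ≃+ X, ∀ (a : A) (x : X), f (a • x) = ((h⁻¹ * g) • a) • f x := by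
  constructor
  · rintro ⟨φ⟩
    refine ⟨((Twist.of g).trans φ.toAddEquiv).trans (Twist.of h).symm, fun a x => ?_⟩
    have h1 := φ.map_smul (g • a) (Twist.of g x)
    rw [Twist.smul_of, inv_smul_smul] at h1
    have h2 := Twist.smul_of h (g • a) ((Twist.of h).symm (φ (Twist.of g x)))
    rw [AddEquiv.apply_symm_apply, ← h1, smul_smul] at h2
    exact congrArg (Twist.of h).symm h2
  · rintro ⟨f, hf⟩
    refine ⟨{ ((Twist.of g).symm.trans f).trans (Twist.of h) with map_smul' := fun a x => ?_ }⟩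
    have h1 := hf (g⁻¹ • a) ((Twist.of g).symm x)
    rw [smul_smul, mul_assoc, mul_inv_cancel, mul_one] at h1
    exact congrArg (Twist.of h) h1

theorem Twist.nonempty_linearEquiv_self_iff (g : G) :
    Nonempty (Twist g X ≃ₗ[A] X) ↔
      ∃ f : X ≃+ X, ∀ (a : A) (x : X), f (a • x) = (g • a) • f x := by
  let e : Twist (1 : G) X ≃ₗ[A] X :=
    { (Twist.of (1 : G)).symm with
      map_smul' := fun a x => congrArg (fun b : A => b • (Twist.of (1 : G)).symm x)
        (show (1 : G)⁻¹ • a = a by rw [inv_one, one_smul]) }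
  have h := Twist.nonempty_linearEquiv_iff (A := A) (X := X) g 1
  rw [inv_one, one_mul] at h
  rw [← h]
  exact ⟨fun ⟨φ⟩ => ⟨φ.trans e.symm⟩, fun ⟨φ⟩ => ⟨φ.trans e⟩⟩

variable (G A X) in
/-- The subgroup of the `g : G` with `ᵍX ≅ X`. -/
def twistStabilizer : Subgroup G where
  carrier := {g | ∃ f : X ≃+ X, ∀ (a : A) (x : X), f (a • x) = (g • a) • f x}
  one_mem' := ⟨AddEquiv.refl X, fun a x => by simp⟩
  mul_mem' := by
    rintro g h ⟨f, hf⟩ ⟨f', hf'⟩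
    exact ⟨f'.trans f, fun a x => by simp [hf, hf', mul_smul]⟩
  inv_mem' := by
    rintro g ⟨f, hf⟩
    refine ⟨f.symm, fun a x => ?_⟩
    apply f.injective
    rw [hf, smul_inv_smul, f.apply_symm_apply, f.apply_symm_apply]

theorem mem_twistStabilizer {g : G} :
    g ∈ twistStabilizer G A X ↔ Nonempty (Twist g X ≃ₗ[A] X) :=
  (Twist.nonempty_linearEquiv_self_iff g).symm

theorem Twist.nonempty_linearEquiv_iff_mem (g h : G) :
    Nonempty (Twist g X ≃ₗ[A] Twist h X) ↔ h⁻¹ * g ∈ twistStabilizer G A X :=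
  Twist.nonempty_linearEquiv_iff g h

variable {σ : G} {m : ℕ}
  (hm : IsLeast {j : ℕ | 0 < j ∧ Nonempty (Twist (σ ^ j) X ≃ₗ[A] X)} m)

include hm in
theorem pow_mem_twistStabilizer_iff (j : ℕ) : σ ^ j ∈ twistStabilizer G A X ↔ m ∣ j := by
  have hτ : σ ^ m ∈ twistStabilizer G A X := mem_twistStabilizer.2 hm.1.2
  constructor
  · intro hj
    have h1 : σ ^ (j % m) ∈ twistStabilizer G A X := by
      have h2 : σ ^ j = σ ^ (j % m) * (σ ^ m) ^ (j / m) := by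
        rw [← pow_mul, ← pow_add, Nat.mod_add_div]
      rw [h2] at hj
      exact (Subgroup.mul_mem_cancel_right _ (Subgroup.pow_mem _ hτ _)).1 hj
    by_contra hd
    have h3 : 0 < j % m := Nat.pos_of_ne_zero fun h => hd (Nat.dvd_of_mod_eq_zero h)
    exact absurd (hm.2 ⟨h3, mem_twistStabilizer.1 h1⟩) (not_le.2 (Nat.mod_lt _ hm.1.1))
  · rintro ⟨c, rfl⟩
    rw [pow_mul]
    exact Subgroup.pow_mem _ hτ _

include hm in
theorem mul_orderOf_pow_eq_orderOf : m * orderOf (σ ^ m) = orderOf σ := by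
  have hd : m ∣ orderOf σ := (pow_mem_twistStabilizer_iff hm _).1 (by
    rw [pow_orderOf_eq_one]; exact one_mem _)
  rw [orderOf_pow_of_dvd hm.1.1.ne' hd, Nat.mul_div_cancel' hd]

include hm in
theorem isEmpty_twist_pow_linearEquiv {i j : Fin m} (hij : i ≠ j) :
    IsEmpty (Twist (σ ^ (i : ℕ)) X ≃ₗ[A] Twist (σ ^ (j : ℕ)) X) := by
  rw [← not_nonempty_iff]
  have key : ∀ i j : Fin m, i < j → ¬ Nonempty (Twist (σ ^ (j : ℕ)) X ≃ₗ[A]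
      Twist (σ ^ (i : ℕ)) X) := by
    intro i j hij hn
    rw [Twist.nonempty_linearEquiv_iff_mem] at hn
    have h1 : (σ ^ (i : ℕ))⁻¹ * σ ^ (j : ℕ) = σ ^ ((j : ℕ) - i) := by
      rw [inv_mul_eq_iff_eq_mul, ← pow_add]; congr 1; omega
    rw [h1, pow_mem_twistStabilizer_iff hm] at hn
    have := Nat.le_of_dvd (by omega) hn
    omega
  rcases lt_or_gt_of_ne hij with h | h
  · exact fun ⟨e⟩ => key i j h ⟨e.symm⟩
  · exact key j i h

theorem Twist.isLocalRing_end [IsLocalRing (Module.End A X)] (g : G) :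
    IsLocalRing (Module.End A (Twist g X)) := by
  let e : Module.End A X →+* Module.End A (Twist g X) :=
    { toFun := fun f => { f.toAddMonoidHom with map_smul' := fun a x => f.map_smul (g⁻¹ • a) x }
      map_one' := rfl
      map_mul' := fun _ _ => rfl
      map_zero' := rfl
      map_add' := fun _ _ => rfl }
  have : Nontrivial (Module.End A (Twist g X)) := by
    obtain ⟨x, hx⟩ : ∃ x : X, x ≠ 0 := by
      by_contra! h
      exact one_ne_zero (α := Module.End A X) (LinearMap.ext fun x => h x)
    exact ⟨1, 0, fun h => hx (LinearMap.congr_fun h (Twist.of g x))⟩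
  have he : Function.Surjective e := by
    intro f
    refine ⟨{ f.toAddMonoidHom with map_smul' := fun a x => ?_ }, rfl⟩
    have h := f.map_smul (g • a) (Twist.of g x)
    rw [Twist.smul_of, inv_smul_smul] at h
    exact h.trans
      (congrArg (fun b : A => b • ((Twist.of g).symm (f (Twist.of g x)))) (inv_smul_smul g a))
  refine ⟨fun {a b} hab => ?_⟩
  obtain ⟨a, rfl⟩ := he a
  obtain ⟨b, rfl⟩ := he b
  rw [← map_add] at hab
  have hab' : a + b = 1 := LinearMap.ext fun x => LinearMap.congr_fun hab (Twist.of g x)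
  exact (IsLocalRing.isUnit_or_isUnit_of_add_one hab').imp (·.map e) (·.map e)

end

/-! ### Normalized isomorphisms -/

/-- An element that is nilpotent up to a nonzero scalar `c` has a polynomial as an `r`-th root of
its inverse, when `r` is invertible in the algebraically closed field: Newton's method in
`k[T] / (T - c) ^ N`, starting from an `r`-th root of `c⁻¹`. -/
theorem exists_mul_aeval_pow_eq_one {k : Type*} [Field k] [IsAlgClosed k] {E : Type*} [Ring E]
    [Algebra k E] (g : E) {c : k} (hc : c ≠ 0) (hg : IsNilpotent (g - algebraMap k E c)) {r : ℕ}
    (hr : (r : k) ≠ 0) : ∃ p : Polynomial k, g * Polynomial.aeval g p ^ r = 1 := by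
  open Polynomial in
  obtain ⟨N, hN⟩ := hg
  have hr0 : 0 < r := Nat.pos_of_ne_zero (by rintro rfl; simp at hr)
  let I : Ideal k[X] := Ideal.span {(X - C c) ^ N}
  let S := k[X] ⧸ I
  let t : S := Ideal.Quotient.mk I X
  have ht : IsNilpotent (t - algebraMap k S c) := by
    refine ⟨N, ?_⟩
    change (Ideal.Quotient.mk I (X - C c)) ^ N = 0
    rw [← map_pow, Ideal.Quotient.eq_zero_iff_mem]
    exact Ideal.mem_span_singleton_self _
  obtain ⟨μ, hμ⟩ := IsAlgClosed.exists_pow_nat_eq c⁻¹ hr0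
  have hμ0 : μ ≠ 0 := by
    rintro rfl
    rw [zero_pow hr0.ne'] at hμ
    exact inv_ne_zero hc hμ.symm
  have htu : IsUnit t := by
    have h := ht.isUnit_add_left_of_commute ((isUnit_iff_ne_zero.2 hc).map (algebraMap k S))
      (Commute.all _ _)
    rwa [add_sub_cancel] at h
  let P : S[X] := C t * X ^ r - 1
  have hder : derivative P = C t * (C (r : S) * X ^ (r - 1)) := by
    rw [derivative_sub, derivative_C_mul, derivative_X_pow, derivative_one, sub_zero]
  have h1 : IsNilpotent (aeval (algebraMap k S μ) P) := by
    have : aeval (algebraMap k S μ) P = (t - algebraMap k S c) * algebraMap k S c⁻¹ := by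
      have hcc : algebraMap k S c * algebraMap k S c⁻¹ = 1 := by
        rw [← map_mul, mul_inv_cancel₀ hc, map_one]
      rw [sub_mul, hcc]
      simp [P, ← map_pow, hμ]
    rw [this]
    exact (Commute.all _ _).isNilpotent_mul_right ht
  have h2 : IsUnit (aeval (algebraMap k S μ) (derivative P)) := by
    have : aeval (algebraMap k S μ) (derivative P) =
        t * (algebraMap k S r * algebraMap k S μ ^ (r - 1)) := by
      rw [hder]
      simp
    rw [this]
    exact htu.mul (((isUnit_iff_ne_zero.2 hr).map _).mul
      (((isUnit_iff_ne_zero.2 hμ0).map _).pow _))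
  obtain ⟨s, ⟨-, hs⟩, -⟩ := existsUnique_nilpotent_sub_and_aeval_eq_zero h1 h2
  obtain ⟨p, rfl⟩ := Ideal.Quotient.mk_surjective s
  refine ⟨p, ?_⟩
  have h3 : X * p ^ r - 1 ∈ I := by
    rw [← Ideal.Quotient.eq_zero_iff_mem]
    simpa [P] using hs
  obtain ⟨q, hq⟩ := Ideal.mem_span_singleton.1 h3
  have h4 := congrArg (aeval g) hq
  simp only [map_sub, map_mul, map_pow, aeval_X, map_one, aeval_C, hN, zero_mul] at h4
  exact sub_eq_zero.1 h4

section
variable {k : Type*} [Field k] {G : Type*} [Group G]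
  {A : Type*} [Ring A] [Algebra k A] [MulSemiringAction G A] [SMulCommClass G k A]
  {X : Type*} [AddCommGroup X] [Module k X] [Module A X] [IsScalarTower k A X]

theorem Twist.underlying_smul {τ : G} (φ : Twist τ X ≃ₗ[A] X) (a : A) (x : X) :
    Twist.underlying (k := k) φ (a • x) = (τ • a) • Twist.underlying (k := k) φ x := by
  have h := φ.map_smul (τ • a) (Twist.of τ x)
  rwa [Twist.smul_of, inv_smul_smul] at h

theorem Twist.underlying_pow_smul {τ : G} (φ : Twist τ X ≃ₗ[A] X) (n : ℕ) (a : A) (x : X) :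
    ((Twist.underlying (k := k) φ) ^ n) (a • x) =
      (τ ^ n • a) • ((Twist.underlying (k := k) φ) ^ n) x := by
  induction n generalizing a x with
  | zero => simp
  | succ n ih =>
    rw [pow_succ, LinearEquiv.mul_apply, Twist.underlying_smul, ih, pow_succ, mul_smul,
      LinearEquiv.mul_apply]

theorem Twist.underlying_pow_apply {τ : G} (φ : Twist τ X ≃ₗ[A] X) (n : ℕ) (x : X) :
    ((Twist.underlying (k := k) φ) ^ n) x = (fun y : X => φ (Twist.of τ y))^[n] x := by
  induction n generalizing x with
  | zero => rfl
  | succ n ih => rw [pow_succ, Function.iterate_succ_apply, ← ih]; rfl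

variable (k) in
/-- If `f` is the bijection of `X` underlying `φ : ^τX ≅ X` and `r` is the order of `τ`, then `f ^ r`
is an automorphism of the module `X`; an `r`-th root of its inverse that is a polynomial in `f ^ r`
commutes with `f`, and multiplying `f` by it makes the `r`-th power trivial. -/
theorem exists_isNormalizedIso [IsAlgClosed k] [FiniteDimensional k X]
    (hX : IsIndecomposableModule A X) {τ : G} (hτ : (orderOf τ : k) ≠ 0)
    (φ : Twist τ X ≃ₗ[A] X) : ∃ ψ : Twist τ X ≃ₗ[A] X, IsNormalizedIso ψ := by
  have := hX.1
  have : IsArtinian A X := isArtinian_of_tower k inferInstance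
  set r := orderOf τ
  have hr0 : r ≠ 0 := by rintro h; simp [h] at hτ
  set f := Twist.underlying (k := k) φ
  let g : Module.End A X :=
    { toFun := fun x => (f ^ r) x
      map_add' := fun x y => map_add _ x y
      map_smul' := fun a x => by
        rw [Twist.underlying_pow_smul, pow_orderOf_eq_one, one_smul]; rfl }
  have hgf : ∀ x, g x = (f ^ r) x := fun _ => rfl
  obtain ⟨c, n, hgn⟩ := hX.exists_isNilpotent_sub (k := k) g
  have hc : c ≠ 0 := by
    rintro rfl
    rw [map_zero, sub_zero] at hgn
    have h2 : ∀ (n : ℕ) (x : X), (g ^ n) x = 0 → x = 0 := by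
      intro n
      induction n with
      | zero => intro x hx; exact hx
      | succ n ih =>
        intro x hx
        rw [pow_succ, Module.End.mul_apply] at hx
        exact (f ^ r).map_eq_zero_iff.1 (ih _ hx)
    obtain ⟨x, hx⟩ := exists_ne (0 : X)
    exact hx (h2 n x (by rw [hgn]; rfl))
  obtain ⟨p, hp⟩ := exists_mul_aeval_pow_eq_one g hc ⟨n, hgn⟩ hτ
  set U : Module.End A X := Polynomial.aeval g p with hU
  have hcomm_pow : ∀ (n : ℕ) (x : X), f ((g ^ n) x) = (g ^ n) (f x) := by
    intro n
    induction n with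
    | zero => intro x; rfl
    | succ n ih =>
      intro x
      rw [pow_succ, Module.End.mul_apply, Module.End.mul_apply, ih, hgf, hgf,
        ← LinearEquiv.mul_apply, ← LinearEquiv.mul_apply, ← pow_succ, ← pow_succ']
  have hcomm_aeval : ∀ (q : Polynomial k) (x : X),
      f (Polynomial.aeval g q x) = Polynomial.aeval g q (f x) := by
    intro q
    induction q using Polynomial.induction_on' with
    | add p q hp' hq' => intro x; simp [hp', hq']
    | monomial n a => intro x; simp [Polynomial.aeval_monomial, hcomm_pow]
  have hcomm : ∀ x, f (U x) = U (f x) := hcomm_aeval p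
  have hUinj : Function.Injective U := by
    have h3 : U ^ (r - 1) * U = U ^ r := by rw [← pow_succ]; congr 1; omega
    have h4 : Function.Injective (g * (U ^ (r - 1) * U) : Module.End A X) := by
      rw [h3, hp]; exact Function.injective_id
    rw [← mul_assoc] at h4
    exact Function.Injective.of_comp (f := (g * U ^ (r - 1) : Module.End A X)) h4
  let V : X ≃ₗ[A] X := LinearEquiv.ofBijective U
    (IsArtinian.bijective_of_injective_endomorphism U hUinj)
  refine ⟨φ.trans V, fun x => ?_⟩
  have h5 : (fun y : X => (φ.trans V) (Twist.of τ y)) = U ∘ fun y : X => φ (Twist.of τ y) := rfl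
  have h6 : Function.Commute U fun y : X => φ (Twist.of τ y) := fun y => (hcomm y).symm
  rw [h5, h6.comp_iterate, Function.comp_apply, ← Twist.underlying_pow_apply (k := k)]
  have h7 : U * g = g * U := by
    simpa [hU] using congrArg (Polynomial.aeval g) (mul_comm p Polynomial.X)
  have h8 : U ^ r * g = 1 := by
    rw [← hp]; exact (Commute.pow_left h7 r)
  have h9 := LinearMap.congr_fun h8 x
  rw [Module.End.mul_apply, hgf, Module.End.pow_apply] at h9
  exact h9

end

/-! ### Induced modules -/

namespace Induced
variable {R S : Type*} [Ring R] [Ring S] (f : R →+* S) {M : Type*} [AddCommGroup M] [Module R M]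

/-- The canonical map `M → S ⊗_R M`, `x ↦ 1 ⊗ x`. -/
def unit : M →+ Induced f M :=
  (Submodule.mkQ (Submodule.span S
    {z : S ⊗[ℤ] M | ∃ (s : S) (a : R) (x : M),
      z = (s * f a) ⊗ₜ[ℤ] x - s ⊗ₜ[ℤ] (a • x)})).toAddMonoidHom.comp
    (TensorProduct.mk ℤ S M 1).toAddMonoidHom

theorem smul_unit (s : S) (x : M) :
    s • unit f x = Submodule.Quotient.mk (p := Submodule.span S
    {z : S ⊗[ℤ] M | ∃ (s : S) (a : R) (x : M),
      z = (s * f a) ⊗ₜ[ℤ] x - s ⊗ₜ[ℤ] (a • x)}) (s ⊗ₜ[ℤ] x) := by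
  refine congrArg (Submodule.Quotient.mk (p := Submodule.span S
    {z : S ⊗[ℤ] M | ∃ (s : S) (a : R) (x : M),
      z = (s * f a) ⊗ₜ[ℤ] x - s ⊗ₜ[ℤ] (a • x)})) (?_ : s • ((1 : S) ⊗ₜ[ℤ] x) = _)
  rw [TensorProduct.smul_tmul', smul_eq_mul, mul_one]

theorem unit_smul (a : R) (x : M) : unit f (a • x) = f a • unit f x := by
  rw [smul_unit, ← one_smul S (unit f (a • x)), smul_unit]
  refine ((Submodule.Quotient.eq _).2 (Submodule.subset_span ?_)).symm
  exact ⟨1, a, x, by rw [one_mul]⟩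

@[elab_as_elim]
theorem induction {P : Induced f M → Prop} (z : Induced f M)
    (hsmul : ∀ (s : S) (x : M), P (s • unit f x)) (hadd : ∀ y z, P y → P z → P (y + z)) : P z := by
  obtain ⟨z, rfl⟩ := Submodule.Quotient.mk_surjective _ z
  induction z using TensorProduct.induction_on with
  | zero =>
    have := hsmul 0 0
    rwa [zero_smul] at this
  | tmul s x =>
    have := hsmul s x
    rwa [smul_unit] at this
  | add y z hy hz => exact hadd _ _ hy hz

theorem hom_ext {Y : Type*} [AddCommGroup Y] [Module S Y] {F F' : Induced f M →ₗ[S] Y}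
    (h : ∀ x, F (unit f x) = F' (unit f x)) : F = F' := by
  refine LinearMap.ext fun z => ?_
  induction z using Induced.induction f with
  | hsmul s x => rw [map_smul, map_smul, h]
  | hadd y z hy hz => rw [map_add, map_add, hy, hz]

theorem apply_zsmul_apply {N : Type*} [AddCommGroup N] (L : S →+ M →+ N) (n : ℤ) (s : S) (x : M) :
    L (n • s) x = L s (n • x) := by
  rw [map_zsmul, map_zsmul, AddMonoidHom.coe_smul, Pi.smul_apply]

/-- The additive map out of `S ⊗_R M` given by a balanced biadditive map. -/
def liftAdd {N : Type*} [AddCommGroup N] (L : S →+ M →+ N)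
    (hL : ∀ (s : S) (a : R) (x : M), L (s * f a) x = L s (a • x)) : Induced f M →+ N :=
  QuotientAddGroup.lift _ (TensorProduct.liftAddHom L (apply_zsmul_apply L)) (by
    intro z hz
    -- the relations are stable under left multiplication, hence the quantifier over `s`
    suffices h : ∀ s : S, TensorProduct.liftAddHom L (apply_zsmul_apply L) (s • z) = 0 by
      have := h 1
      rwa [one_smul] at this
    have hz' : z ∈ Submodule.span S {z : S ⊗[ℤ] M | ∃ (s : S) (a : R) (x : M),
      z = (s * f a) ⊗ₜ[ℤ] x - s ⊗ₜ[ℤ] (a • x)} := hz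
    clear hz
    induction hz' using Submodule.span_induction with
    | mem z hz =>
      obtain ⟨s', a, x, rfl⟩ := hz
      intro s
      rw [smul_sub, map_sub, TensorProduct.smul_tmul', TensorProduct.smul_tmul', smul_eq_mul,
        smul_eq_mul, ← mul_assoc]
      exact sub_eq_zero.2 (hL _ _ _)
    | zero => intro s; rw [smul_zero, map_zero]
    | add y z _ _ hy hz => intro s; rw [smul_add, map_add, hy, hz, add_zero]
    | smul a y _ hy => intro s; rw [smul_smul]; exact hy _)

theorem liftAdd_smul_unit {N : Type*} [AddCommGroup N] (L : S →+ M →+ N)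
    (hL : ∀ (s : S) (a : R) (x : M), L (s * f a) x = L s (a • x)) (s : S) (x : M) :
    liftAdd f L hL (s • unit f x) = L s x := by
  rw [smul_unit]
  rfl

/-- The universal property of the induced module. -/
def lift {Y : Type*} [AddCommGroup Y] [Module S Y] (h : M →+ Y)
    (hh : ∀ (a : R) (x : M), h (a • x) = f a • h x) : Induced f M →ₗ[S] Y :=
  let F := liftAdd f
    ((AddMonoidHom.compHom.flip h).comp (Module.toAddMonoidEnd S Y).toAddMonoidHom :
      S →+ M →+ Y) (fun s a x => by
        change (s * f a) • h x = s • h (a • x)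
        rw [hh, mul_smul])
  { F with
    map_smul' := fun s z => by
      change F (s • z) = s • F z
      induction z using Induced.induction f with
      | hsmul s' x =>
        rw [smul_smul, liftAdd_smul_unit, liftAdd_smul_unit]
        exact mul_smul s s' (h x)
      | hadd y z hy hz => rw [smul_add, map_add, hy, hz, map_add, smul_add] }

theorem lift_unit {Y : Type*} [AddCommGroup Y] [Module S Y] (h : M →+ Y)
    (hh : ∀ (a : R) (x : M), h (a • x) = f a • h x) (x : M) : lift f h hh (unit f x) = h x := by
  rw [← one_smul S (unit f x), map_smul, one_smul]
  have := liftAdd_smul_unit f ((AddMonoidHom.compHom.flip h).comp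
    (Module.toAddMonoidEnd S Y).toAddMonoidHom : S →+ M →+ Y) (fun s a x => by
        change (s * f a) • h x = s • h (a • x)
        rw [hh, mul_smul]) 1 x
  rw [one_smul] at this
  exact this.trans (one_smul S (h x))

end Induced

/-! ### Modules over skew group algebras of cyclic groups -/

section
variable {G : Type*} [Group G] (A : Type*) [Ring A] [MulSemiringAction G A]

/-- The element `1 # τ` of the skew group algebra `A # k⟨τ⟩`. -/
def skewGen (τ : G) : SkewMonoidAlgebra A (Subgroup.zpowers τ) :=
  SkewMonoidAlgebra.of A _ ⟨τ, Subgroup.mem_zpowers τ⟩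

variable {A}

theorem single_eq_baseHom_mul_of (τ : G) (g : Subgroup.zpowers τ) (a : A) :
    SkewMonoidAlgebra.single g a = baseHom A τ a * SkewMonoidAlgebra.of A _ g := by
  change _ = SkewMonoidAlgebra.single 1 a * SkewMonoidAlgebra.single g 1
  rw [SkewMonoidAlgebra.single_mul_single, one_mul, smul_one, mul_one]

theorem of_mul_baseHom (τ : G) (g : Subgroup.zpowers τ) (a : A) :
    SkewMonoidAlgebra.of A _ g * baseHom A τ a =
      baseHom A τ ((g : G) • a) * SkewMonoidAlgebra.of A _ g := by
  rw [← single_eq_baseHom_mul_of]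
  change SkewMonoidAlgebra.single g 1 * SkewMonoidAlgebra.single 1 a = _
  rw [SkewMonoidAlgebra.single_mul_single, one_mul, mul_one]
  rfl

theorem skewGen_pow (τ : G) (n : ℕ) :
    skewGen A τ ^ n = SkewMonoidAlgebra.of A _ (⟨τ ^ n, n, by simp⟩ : Subgroup.zpowers τ) := by
  rw [skewGen, ← map_pow]
  rfl

theorem skewGen_pow_orderOf (τ : G) : skewGen A τ ^ orderOf τ = 1 := by
  rw [skewGen, ← map_pow, ← Subgroup.orderOf_mk τ (Subgroup.mem_zpowers τ), pow_orderOf_eq_one,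
    map_one]

theorem skewGen_pow_mul_baseHom (τ : G) (n : ℕ) (a : A) :
    skewGen A τ ^ n * baseHom A τ a = baseHom A τ (τ ^ n • a) * skewGen A τ ^ n := by
  rw [skewGen_pow, of_mul_baseHom]

theorem exists_of_eq_skewGen_pow {τ : G} (hτ : 0 < orderOf τ) (g : Subgroup.zpowers τ) :
    ∃ n : ℕ, SkewMonoidAlgebra.of A _ g = skewGen A τ ^ n := by
  obtain ⟨g, hg⟩ := g
  obtain ⟨n, rfl⟩ := (orderOf_pos_iff.1 hτ).mem_powers_iff_mem_zpowers.2 hg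
  exact ⟨n, (skewGen_pow τ n).symm⟩

/-- An additive map of modules over `A # k⟨τ⟩` is linear as soon as it is `A`-linear and commutes
with `τ`. -/
theorem map_smul_of_skewGen {τ : G} (hτ : 0 < orderOf τ) {Y Z : Type*} [AddCommGroup Y]
    [AddCommGroup Z] [Module (SkewMonoidAlgebra A (Subgroup.zpowers τ)) Y]
    [Module (SkewMonoidAlgebra A (Subgroup.zpowers τ)) Z] (F : Y →+ Z)
    (hA : ∀ (a : A) y, F (baseHom A τ a • y) = baseHom A τ a • F y)
    (ht : ∀ y, F (skewGen A τ • y) = skewGen A τ • F y)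
    (s : SkewMonoidAlgebra A (Subgroup.zpowers τ)) (y : Y) : F (s • y) = s • F y := by
  have hpow : ∀ (n : ℕ) (y : Y), F (skewGen A τ ^ n • y) = skewGen A τ ^ n • F y := by
    intro n
    induction n with
    | zero => intro y; simp
    | succ n ih => intro y; rw [pow_succ, mul_smul, mul_smul, ih, ht]
  induction s using SkewMonoidAlgebra.induction_on with
  | zero => simp
  | single g a =>
    obtain ⟨n, hn⟩ := exists_of_eq_skewGen_pow (A := A) hτ g
    rw [single_eq_baseHom_mul_of, hn, mul_smul, mul_smul, hA, hpow]
  | add s s' h h' => rw [add_smul, add_smul, map_add, h, h']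

variable (σ : G) (m : ℕ)

theorem powHom_of (g : Subgroup.zpowers (σ ^ m)) :
    powHom A σ m (SkewMonoidAlgebra.of A _ g) =
      SkewMonoidAlgebra.of A _ (Subgroup.inclusion (zpowers_pow_le σ m) g) :=
  SkewMonoidAlgebra.mapDomain_single

theorem powHom_baseHom (a : A) : powHom A σ m (baseHom A (σ ^ m) a) = baseHom A σ a :=
  SkewMonoidAlgebra.mapDomain_single

theorem powHom_skewGen : powHom A σ m (skewGen A (σ ^ m)) = skewGen A σ ^ m := by
  rw [skewGen_pow]
  exact powHom_of σ m _

variable {M : Type*} [AddCommGroup M] [Module (SkewMonoidAlgebra A (Subgroup.zpowers (σ ^ m))) M]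

open Classical in
/-- The biadditive map `(a # g, x) ↦ (a # g) x` if `g ∈ ⟨σ ^ m⟩`, and `0` otherwise. -/
def cosetPairing : SkewMonoidAlgebra A (Subgroup.zpowers σ) →+ M →+ M :=
  SkewMonoidAlgebra.liftNC
    (((Module.toAddMonoidEnd _ M).comp (baseHom A (σ ^ m)) : A →+* AddMonoid.End M) :
      A →+ AddMonoid.End M)
    fun g => if h : (g : G) ∈ Subgroup.zpowers (σ ^ m) then
      Module.toAddMonoidEnd _ M (SkewMonoidAlgebra.of A _ (⟨g, h⟩ : Subgroup.zpowers (σ ^ m))) else 0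

theorem cosetPairing_single_of_mem (g : Subgroup.zpowers σ) (a : A)
    (h : (g : G) ∈ Subgroup.zpowers (σ ^ m)) (x : M) :
    cosetPairing σ m (SkewMonoidAlgebra.single g a) x =
      SkewMonoidAlgebra.single (⟨g, h⟩ : Subgroup.zpowers (σ ^ m)) a • x := by
  refine (congrArg (fun F : AddMonoid.End M => F x)
    (SkewMonoidAlgebra.liftNC_single _ _ g a)).trans ?_
  rw [dif_pos h, single_eq_baseHom_mul_of, mul_smul]
  rfl

theorem cosetPairing_single_of_notMem (g : Subgroup.zpowers σ) (a : A)
    (h : (g : G) ∉ Subgroup.zpowers (σ ^ m)) (x : M) :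
    cosetPairing σ m (SkewMonoidAlgebra.single g a) x = 0 := by
  refine (congrArg (fun F : AddMonoid.End M => F x)
    (SkewMonoidAlgebra.liftNC_single _ _ g a)).trans ?_
  rw [dif_neg h, mul_zero]
  rfl

theorem cosetPairing_mul_powHom (s : SkewMonoidAlgebra A (Subgroup.zpowers σ))
    (b : SkewMonoidAlgebra A (Subgroup.zpowers (σ ^ m))) (x : M) :
    cosetPairing σ m (s * powHom A σ m b) x = cosetPairing σ m s (b • x) := by
  induction s using SkewMonoidAlgebra.induction_on with
  | zero => simp
  | add s s' h h' => rw [add_mul, map_add, map_add, AddMonoidHom.add_apply, h, h']; rfl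
  | single g a =>
    induction b using SkewMonoidAlgebra.induction_on with
    | zero => simp
    | add s s' h h' => rw [map_add, mul_add, map_add, AddMonoidHom.add_apply, h, h', add_smul, map_add]
    | single h b =>
      have h1 : powHom A σ m (SkewMonoidAlgebra.single h b) =
        SkewMonoidAlgebra.single (Subgroup.inclusion (zpowers_pow_le σ m) h) b :=
          SkewMonoidAlgebra.mapDomain_single
      rw [h1, SkewMonoidAlgebra.single_mul_single]
      by_cases hg : (g : G) ∈ Subgroup.zpowers (σ ^ m)
      · have hgh : ((g * Subgroup.inclusion (zpowers_pow_le σ m) h : Subgroup.zpowers σ) : G) ∈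
            Subgroup.zpowers (σ ^ m) := mul_mem hg h.2
        rw [cosetPairing_single_of_mem _ _ _ _ hg, cosetPairing_single_of_mem _ _ _ _ hgh,
          smul_smul, SkewMonoidAlgebra.single_mul_single]
        rfl
      · have hgh : ((g * Subgroup.inclusion (zpowers_pow_le σ m) h : Subgroup.zpowers σ) : G) ∉
            Subgroup.zpowers (σ ^ m) := fun h' => hg ((Subgroup.mul_mem_cancel_right _ h.2).1 h')
        rw [cosetPairing_single_of_notMem _ _ _ _ hg, cosetPairing_single_of_notMem _ _ _ _ hgh]

theorem inv_pow_mul_pow_mem_zpowers_iff {σ : G} {m : ℕ} (hd : m ∣ orderOf σ) (i j : Fin m) :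
    (σ ^ (i : ℕ))⁻¹ * σ ^ (j : ℕ) ∈ Subgroup.zpowers (σ ^ m) ↔ i = j := by
  constructor
  · rintro ⟨q, hq⟩
    have h1 : σ ^ ((m : ℤ) * q) = σ ^ ((j : ℤ) - i) := by
      rw [zpow_mul, zpow_natCast, sub_eq_neg_add, zpow_add, zpow_neg, zpow_natCast, zpow_natCast]
      exact hq
    have h2 := orderOf_dvd_sub_iff_zpow_eq_zpow.2 h1
    have h3 : (m : ℤ) ∣ (j : ℤ) - i :=
      (dvd_sub_right (Dvd.intro q rfl)).1 ((Int.natCast_dvd_natCast.2 hd).trans h2)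
    obtain ⟨c, hc⟩ := h3
    have hi := i.2
    have hj := j.2
    have h5 : c < 1 := by nlinarith
    have h6 : -1 < c := by nlinarith
    have h7 : c = 0 := by omega
    rw [h7, mul_zero] at hc
    exact Fin.ext (by omega)
  · rintro rfl
    simp

/-- `A # k⟨σ⟩` is free as a right module over `A # k⟨σ ^ m⟩`, with basis the powers
`σ ^ j`, `j < m`. -/
theorem Induced.bijective_sum_skewGen_pow (hσ : 0 < orderOf σ) (hm : 0 < m)
    (hd : m ∣ orderOf σ) :
    Function.Bijective (fun x : Fin m → M =>
      ∑ j : Fin m, skewGen A σ ^ (j : ℕ) • Induced.unit (powHom A σ m) (x j)) := by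
  let Φ : (Fin m → M) →+ Induced (powHom A σ m) M :=
    { toFun := fun x => ∑ j : Fin m, skewGen A σ ^ (j : ℕ) • Induced.unit (powHom A σ m) (x j)
      map_zero' := by simp
      map_add' := fun x y => by simp [Finset.sum_add_distrib] }
  change Function.Bijective Φ
  constructor
  · rw [injective_iff_map_eq_zero]
    intro x hx
    funext i
    let g : Fin m → Subgroup.zpowers σ := fun j => ⟨σ ^ (j : ℕ), (j : ℕ), by simp⟩
    have h1 : Induced.liftAdd (powHom A σ m) (cosetPairing σ m)
        (cosetPairing_mul_powHom σ m (M := M)) (SkewMonoidAlgebra.of A _ (g i)⁻¹ • Φ x) = 0 := by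
      rw [hx, smul_zero, map_zero]
    have h2 : ∀ j : Fin m, cosetPairing σ m (SkewMonoidAlgebra.of A _ ((g i)⁻¹ * g j)) (x j) =
        if j = i then x j else 0 := by
      intro j
      split_ifs with h
      · subst h
        rw [inv_mul_cancel]
        change cosetPairing σ m (SkewMonoidAlgebra.single 1 1) (x j) = _
        rw [cosetPairing_single_of_mem _ _ _ _ (one_mem _)]
        exact one_smul _ (x j)
      · exact cosetPairing_single_of_notMem _ _ _ _
          (fun h' => h ((inv_pow_mul_pow_mem_zpowers_iff hd i j).1 h').symm) _
    have h3 : SkewMonoidAlgebra.of A _ (g i)⁻¹ • Φ x = ∑ j : Fin m,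
        SkewMonoidAlgebra.of A _ ((g i)⁻¹ * g j) • Induced.unit (powHom A σ m) (x j) := by
      change _ • ∑ j : Fin m, _ = _
      rw [Finset.smul_sum]
      refine Finset.sum_congr rfl fun j _ => ?_
      rw [smul_smul, skewGen_pow, ← map_mul]
    rw [h3, map_sum, Finset.sum_congr rfl fun j _ =>
      (Induced.liftAdd_smul_unit (powHom A σ m) (cosetPairing σ m)
        (cosetPairing_mul_powHom σ m (M := M)) _ _).trans (h2 j)] at h1
    simpa using h1
  · intro z
    induction z using Induced.induction with
    | hadd y z hy hz =>
      obtain ⟨x, rfl⟩ := hy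
      obtain ⟨x', rfl⟩ := hz
      exact ⟨x + x', map_add _ _ _⟩
    | hsmul s x =>
      induction s using SkewMonoidAlgebra.induction_on with
      | zero => exact ⟨0, by rw [map_zero, zero_smul]⟩
      | add s s' h h' =>
        obtain ⟨z, hz⟩ := h
        obtain ⟨z', hz'⟩ := h'
        exact ⟨z + z', by rw [map_add, hz, hz', add_smul]⟩
      | single g a =>
        obtain ⟨n, hn⟩ := exists_of_eq_skewGen_pow (A := A) hσ g
        have h1 : (SkewMonoidAlgebra.single g a : SkewMonoidAlgebra A (Subgroup.zpowers σ)) =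
            skewGen A σ ^ (n % m) * powHom A σ m (skewGen A (σ ^ m) ^ (n / m) *
              baseHom A (σ ^ m) ((σ ^ n)⁻¹ • a)) := by
          rw [map_mul, map_pow, powHom_skewGen, powHom_baseHom, ← mul_assoc, ← pow_mul, ← pow_add,
            Nat.mod_add_div, skewGen_pow_mul_baseHom, smul_inv_smul, ← hn,
            single_eq_baseHom_mul_of]
        rw [h1, mul_smul, ← Induced.unit_smul]
        refine ⟨Pi.single ⟨n % m, Nat.mod_lt _ hm⟩ ((skewGen A (σ ^ m) ^ (n / m) *
              baseHom A (σ ^ m) ((σ ^ n)⁻¹ • a)) • x), ?_⟩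
        change ∑ j : Fin m, _ = _
        rw [Finset.sum_eq_single ⟨n % m, Nat.mod_lt _ hm⟩]
        · rw [Pi.single_eq_same]
        · intro j _ hj
          rw [Pi.single_eq_of_ne hj, map_zero, smul_zero]
        · simp

end

/-! ### The modules induced from the twists of `X` by characters -/

section
variable {k : Type*} [Field k] {G : Type*} [Group G]
  {A : Type*} [Ring A] [Algebra k A] [MulSemiringAction G A] [SMulCommClass G k A]
  {X : Type*} [AddCommGroup X] [Module k X] [Module A X] [IsScalarTower k A X]

/-- The semilinear automorphism `ζ ^ i φ` of `X`, by which `τ` acts on `L_i ⊗ X = X`. -/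
def charIso (ζ : kˣ) {τ : G} (φ : Twist τ X ≃ₗ[A] X) (i : ℕ) : X ≃ₗ[k] X :=
  DistribMulAction.toModuleAut k X (ζ ^ i) * Twist.underlying φ

section
variable (ζ : kˣ) {τ : G} (φ : Twist τ X ≃ₗ[A] X) (i : ℕ)

theorem charIso_apply (x : X) : charIso ζ φ i x = ((ζ : k) ^ i) • φ (Twist.of τ x) := by
  change (ζ ^ i) • φ (Twist.of τ x) = _
  rw [Units.smul_def, Units.val_pow_eq_pow_val]

theorem charIso_pow (n : ℕ) : charIso ζ φ i ^ n =
    DistribMulAction.toModuleAut k X (ζ ^ (i * n)) * Twist.underlying φ ^ n := by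
  have h : Commute (DistribMulAction.toModuleAut k X (ζ ^ i)) (Twist.underlying φ) := by
    refine LinearEquiv.ext fun x => ?_
    change (ζ ^ i) • Twist.underlying (k := k) φ x = Twist.underlying (k := k) φ ((ζ ^ i) • x)
    rw [Units.smul_def, Units.smul_def, map_smul]
  rw [charIso, h.mul_pow, ← map_pow, ← pow_mul]

variable {ζ φ} in
theorem charIso_pow_orderOf (hζ : IsPrimitiveRoot ζ (orderOf τ)) (hφ : IsNormalizedIso φ) :
    charIso ζ φ i ^ orderOf τ = 1 := by
  rw [charIso_pow, Twist.underlying_pow hφ, mul_comm, pow_mul, hζ.pow_eq_one, one_pow, map_one,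
    one_mul]

theorem charIso_smul (a : A) (x : X) : charIso ζ φ i (a • x) = (τ • a) • charIso ζ φ i x := by
  change (ζ ^ i) • Twist.underlying (k := k) φ (a • x) =
    (τ • a) • ((ζ ^ i) • Twist.underlying (k := k) φ x)
  rw [Twist.underlying_smul, Units.smul_def, Units.smul_def, algebra_compatible_smul A,
    algebra_compatible_smul A, smul_smul, smul_smul, Algebra.commutes]

theorem charIso_inv_smul (a : A) (x : X) :
    (charIso ζ φ i)⁻¹ (a • x) = (τ⁻¹ • a) • (charIso ζ φ i)⁻¹ x := by
  apply (charIso ζ φ i).injective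
  rw [charIso_smul, smul_inv_smul]
  exact ((charIso ζ φ i).apply_symm_apply _).trans
    (congrArg (a • ·) ((charIso ζ φ i).apply_symm_apply x).symm)

theorem charIso_inv_pow_smul (n : ℕ) (a : A) (x : X) :
    ((charIso ζ φ i)⁻¹ ^ n) (a • x) = ((τ ^ n)⁻¹ • a) • ((charIso ζ φ i)⁻¹ ^ n) x := by
  induction n generalizing a x with
  | zero => simp
  | succ n ih =>
    rw [pow_succ, LinearEquiv.mul_apply, charIso_inv_smul, ih, smul_smul, pow_succ', mul_inv_rev,
      LinearEquiv.mul_apply]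

end

variable {σ : G} {m : ℕ} {ζ : kˣ} (hζ : IsPrimitiveRoot ζ (orderOf (σ ^ m)))
  {φ : Twist (σ ^ m) X ≃ₗ[A] X} (hφ : IsNormalizedIso φ) (i : ℕ)

/-- The identification of the underlying group of `L_i ⊗ X` with `X`. -/
def CharTensor.equiv : X ≃+ CharTensor hζ hφ i :=
  (TensorProduct.lid k X).symm.toAddEquiv

theorem CharTensor.baseHom_smul (a : A) (x : X) :
    baseHom A (σ ^ m) a • CharTensor.equiv hζ hφ i x = CharTensor.equiv hζ hφ i (a • x) := by
  refine (skewTensorHom_single (powerRep (σ ^ m) hζ i) (isoRep k hφ) (isoRep_smul hφ) 1 a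
    1 x).trans ?_
  rw [map_one (powerRep (σ ^ m) hζ i), map_one (isoRep k hφ)]
  rfl

theorem CharTensor.skewGen_smul (x : X) :
    skewGen A (σ ^ m) • CharTensor.equiv hζ hφ i x =
      CharTensor.equiv hζ hφ i (charIso ζ φ i x) := by
  refine (skewTensorHom_single (powerRep (σ ^ m) hζ i) (isoRep k hφ) (isoRep_smul hφ) _ 1
    1 x).trans ?_
  rw [powerRep_gen, mul_one, one_smul]
  have h1 : isoRep k hφ ⟨σ ^ m, Subgroup.mem_zpowers (σ ^ m)⟩ x = φ (Twist.of _ x) :=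
    cyclicRep_gen _ _ _ x
  rw [h1]
  have h2 : ((ζ : k) ^ i) ⊗ₜ[k] φ (Twist.of _ x) = (1 : k) ⊗ₜ[k] (charIso ζ φ i x) := by
    rw [charIso_apply, ← TensorProduct.smul_tmul, smul_eq_mul, mul_one]
  exact h2

/-- The module `(A # k⟨σ⟩) ⊗ (L_i ⊗ X)` over `A # k⟨σ⟩`. -/
abbrev IndCharTensor : Type _ := Induced (powHom A σ m) (CharTensor hζ hφ i)

namespace IndCharTensor

/-- The canonical map `X → (A # k⟨σ⟩) ⊗ (L_i ⊗ X)`. -/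
def unit : X →+ IndCharTensor hζ hφ i :=
  (Induced.unit (powHom A σ m)).comp (CharTensor.equiv hζ hφ i).toAddMonoidHom

theorem unit_smul (a : A) (x : X) : unit hζ hφ i (a • x) = baseHom A σ a • unit hζ hφ i x := by
  change Induced.unit (powHom A σ m) (CharTensor.equiv hζ hφ i (a • x)) = _
  rw [← CharTensor.baseHom_smul, Induced.unit_smul, powHom_baseHom]
  rfl

theorem skewGen_pow_smul_unit (x : X) :
    skewGen A σ ^ m • unit hζ hφ i x = unit hζ hφ i (charIso ζ φ i x) := by
  change _ = Induced.unit (powHom A σ m) (CharTensor.equiv hζ hφ i (charIso ζ φ i x))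
  rw [← CharTensor.skewGen_smul, Induced.unit_smul, powHom_skewGen]
  rfl

variable {hζ hφ i} in
theorem hom_ext {Y : Type*} [AddCommGroup Y] [Module (SkewMonoidAlgebra A (Subgroup.zpowers σ)) Y]
    {F F' : IndCharTensor hζ hφ i →ₗ[SkewMonoidAlgebra A (Subgroup.zpowers σ)] Y}
    (h : ∀ x, F (unit hζ hφ i x) = F' (unit hζ hφ i x)) : F = F' := by
  refine Induced.hom_ext _ fun z => ?_
  obtain ⟨x, rfl⟩ := (CharTensor.equiv hζ hφ i).surjective z
  exact h x

/-- Frobenius reciprocity: a map `h : X → Y` extends to the induced module if it intertwines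
`ζ ^ i φ` with the action of `σ ^ m`. -/
theorem exists_lift (hτ : 0 < orderOf (σ ^ m)) {Y : Type*} [AddCommGroup Y]
    [Module (SkewMonoidAlgebra A (Subgroup.zpowers σ)) Y] (h : X →+ Y)
    (hA : ∀ (a : A) x, h (a • x) = baseHom A σ a • h x)
    (ht : ∀ x, skewGen A σ ^ m • h x = h (charIso ζ φ i x)) :
    ∃ F : IndCharTensor hζ hφ i →ₗ[SkewMonoidAlgebra A (Subgroup.zpowers σ)] Y,
      ∀ x, F (unit hζ hφ i x) = h x := by
  let h' : CharTensor hζ hφ i →+ Restrict (powHom A σ m) Y :=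
    h.comp (CharTensor.equiv hζ hφ i).symm.toAddMonoidHom
  have hh' : ∀ x, h' (CharTensor.equiv hζ hφ i x) = h x := fun x =>
    congrArg h ((CharTensor.equiv hζ hφ i).symm_apply_apply x)
  have key : ∀ (s : SkewMonoidAlgebra A (Subgroup.zpowers (σ ^ m))) z, h' (s • z) = s • h' z := by
    refine map_smul_of_skewGen hτ h' (fun a z => ?_) (fun z => ?_)
    · obtain ⟨x, rfl⟩ := (CharTensor.equiv hζ hφ i).surjective z
      rw [CharTensor.baseHom_smul, hh', hh', hA]
      exact congrArg (· • h x) (powHom_baseHom σ m a).symm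
    · obtain ⟨x, rfl⟩ := (CharTensor.equiv hζ hφ i).surjective z
      rw [CharTensor.skewGen_smul, hh', hh', ← ht]
      exact congrArg (· • h x) (powHom_skewGen σ m).symm
  exact ⟨Induced.lift (powHom A σ m) (Y := Y) h' key, fun x =>
    (Induced.lift_unit (powHom A σ m) (Y := Y) h' key _).trans (hh' x)⟩

end IndCharTensor

variable (σ m) in
/-- The component `x ↦ σ ^ j h (x)` on `^{σ^j}X` of the `A`-linear map from the sum of the twists to
an `(A # k⟨σ⟩)`-module `Y` that is defined by an `A`-linear map `h : X → Y`. -/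
def twistSumMap {Y : Type*} [AddCommGroup Y] [Module (SkewMonoidAlgebra A (Subgroup.zpowers σ)) Y]
    (h : X →+ Y) (hA : ∀ (a : A) x, h (a • x) = baseHom A σ a • h x) (j : Fin m) :
    Twist (σ ^ (j : ℕ)) X →ₗ[A] Restrict (baseHom A σ) Y where
  toFun x := (skewGen A σ ^ (j : ℕ) • h ((Twist.of _).symm x) : Y)
  map_add' x y := by rw [map_add, map_add, smul_add]; rfl
  map_smul' a x := by
    change skewGen A σ ^ (j : ℕ) • h (((σ ^ (j : ℕ))⁻¹ • a) • (Twist.of _).symm x) =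
      baseHom A σ a • (skewGen A σ ^ (j : ℕ) • h ((Twist.of _).symm x))
    rw [hA, smul_smul, skewGen_pow_mul_baseHom, smul_inv_smul, mul_smul]

namespace IndCharTensor

/-- The decomposition as the sum of the twists of `X` of the restriction to `A` of `(A # k⟨σ⟩) ⊗ (L_i ⊗ X)`. -/
def twistEquiv (hσ : 0 < orderOf σ) (hm : 0 < m) (hd : m ∣ orderOf σ) :
    (∀ j : Fin m, Twist (σ ^ (j : ℕ)) X) ≃ₗ[A]
      Restrict (baseHom A σ) (IndCharTensor hζ hφ i) :=
  LinearEquiv.ofBijective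
    (∑ j : Fin m, twistSumMap σ m (unit hζ hφ i) (unit_smul hζ hφ i) j ∘ₗ LinearMap.proj j) (by
      let e : (∀ j : Fin m, Twist (σ ^ (j : ℕ)) X) ≃ (Fin m → CharTensor hζ hφ i) :=
        Equiv.piCongrRight fun j => ((Twist.of _).symm.trans (CharTensor.equiv hζ hφ i)).toEquiv
      have h := (Induced.bijective_sum_skewGen_pow (A := A) σ m hσ hm hd
        (M := CharTensor hζ hφ i)).comp e.bijective
      refine (congrArg Function.Bijective (funext fun x => ?_)).mpr h
      exact LinearMap.sum_apply _ _ _)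

theorem twistEquiv_apply (hσ : 0 < orderOf σ) (hm : 0 < m) (hd : m ∣ orderOf σ)
    (x : ∀ j : Fin m, Twist (σ ^ (j : ℕ)) X) :
    twistEquiv hζ hφ i hσ hm hd x =
      ∑ j : Fin m, twistSumMap σ m (unit hζ hφ i) (unit_smul hζ hφ i) j (x j) :=
  LinearMap.sum_apply _ _ _

end IndCharTensor

end

/-! ### Averaging over a cyclic group -/

theorem geom_sum_eq_zero_of_pow_eq_one {k : Type*} [Field k] {z : k} {r : ℕ} (hz : z ^ r = 1)
    (hz1 : z ≠ 1) : ∑ j ∈ Finset.range r, z ^ j = 0 := by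
  have h := mul_geom_sum z r
  rw [hz, sub_self] at h
  exact (mul_eq_zero.1 h).resolve_left (sub_ne_zero.2 hz1)

theorem IsPrimitiveRoot.eq_of_pow_eq_pow_of_mem_Icc {M : Type*} [CommMonoid M] {ζ : M} {r : ℕ}
    (hζ : IsPrimitiveRoot ζ r) {i j : ℕ} (hi : i ∈ Finset.Icc 1 r) (hj : j ∈ Finset.Icc 1 r)
    (h : ζ ^ i = ζ ^ j) : i = j := by
  rw [Finset.mem_Icc] at hi hj
  have hu : IsUnit ζ := hζ.isUnit (by omega)
  have h1 : ζ ^ (i - 1) = ζ ^ (j - 1) := by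
    refine hu.mul_right_cancel ?_
    rw [← pow_succ, ← pow_succ, Nat.sub_add_cancel hi.1, Nat.sub_add_cancel hj.1, h]
  have := hζ.pow_inj (by omega) (by omega) h1
  omega

theorem IsPrimitiveRoot.sum_inv_pow_Icc {k : Type*} [Field k] {ζ : kˣ} {r : ℕ}
    (hζ : IsPrimitiveRoot ζ r) {j : ℕ} (hj : j < r) :
    ∑ i ∈ Finset.Icc 1 r, ((((ζ ^ i)⁻¹ ^ j : kˣ)) : k) = if j = 0 then (r : k) else 0 := by
  split_ifs with h
  · simp [h]
  · have h1 : ∀ i ∈ Finset.range r, ((((ζ ^ (i + 1))⁻¹ ^ j : kˣ)) : k) =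
        (((ζ⁻¹ ^ j : kˣ)) : k) * (((ζ⁻¹ ^ j : kˣ)) : k) ^ i := by
      intro i _
      rw [← pow_succ', ← Units.val_pow_eq_pow_val, ← inv_pow, ← pow_mul, ← pow_mul, mul_comm]
    have h2 : Finset.Icc 1 r = Finset.Ico (0 + 1) (r + 1) := by
      ext i; simp [Finset.mem_Icc, Finset.mem_Ico]
    rw [h2, ← Finset.sum_Ico_add' (fun i => ((((ζ ^ i)⁻¹ ^ j : kˣ)) : k)) 0 r 1,
      ← Finset.range_eq_Ico, Finset.sum_congr rfl h1, ← Finset.mul_sum,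
      geom_sum_eq_zero_of_pow_eq_one, mul_zero]
    · rw [← Units.val_pow_eq_pow_val, ← pow_mul, mul_comm, pow_mul, inv_pow, hζ.pow_eq_one]
      simp
    · intro h3
      rw [Units.val_eq_one, inv_pow, inv_eq_one] at h3
      exact hζ.pow_ne_one_of_pos_of_lt h hj h3

section
variable {k : Type*} [Field k] {G : Type*} [Group G]
  {A : Type*} [Ring A] [Algebra k A] [MulSemiringAction G A] [SMulCommClass G k A]
  {X : Type*} [AddCommGroup X] [Module k X] [Module A X] [IsScalarTower k A X]

theorem charIso_inv_pow_apply (ζ : kˣ) {τ : G} (φ : Twist τ X ≃ₗ[A] X) (i n : ℕ) (x : X) :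
    ((charIso ζ φ i)⁻¹ ^ n) x =
      (((ζ ^ i)⁻¹ ^ n : kˣ) : k) • ((Twist.underlying (k := k) φ) ^ n)⁻¹ x := by
  have h : (charIso ζ φ i)⁻¹ ^ n = ((Twist.underlying (k := k) φ) ^ n)⁻¹ *
      DistribMulAction.toModuleAut k X ((ζ ^ i)⁻¹ ^ n) := by
    rw [inv_pow, charIso_pow, mul_inv_rev, ← map_inv, pow_mul, inv_pow]
  rw [h, LinearEquiv.mul_apply]
  exact map_smul _ _ _

theorem charIso_pow_inv_pow_apply (ζ : kˣ) {τ : G} (φ : Twist τ X ≃ₗ[A] X) (i l n : ℕ) (x : X) :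
    (charIso ζ φ l ^ n) (((charIso ζ φ i)⁻¹ ^ n) x) =
      ((ζ ^ l * (ζ ^ i)⁻¹ : kˣ) : k) ^ n • x := by
  have h : charIso ζ φ l ^ n * (charIso ζ φ i)⁻¹ ^ n =
      DistribMulAction.toModuleAut k X ((ζ ^ l * (ζ ^ i)⁻¹) ^ n) := by
    rw [inv_pow, charIso_pow, charIso_pow, mul_inv_rev, mul_assoc, mul_inv_cancel_left,
      ← map_inv, ← map_mul, pow_mul, pow_mul, mul_pow, inv_pow]
  rw [← LinearEquiv.mul_apply, h, ← Units.val_pow_eq_pow_val]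
  rfl

variable {σ : G} {m : ℕ} {ζ : kˣ}
  {φ : Twist (σ ^ m) X ≃ₗ[A] X} (i : ℕ)
  {Y : Type*} [AddCommGroup Y] [Module (SkewMonoidAlgebra A (Subgroup.zpowers σ)) Y]

variable (ζ φ) in
/-- The component of `h : X → Y` in the `ζ ^ i`-eigenspace of `h ↦ σ ^ m h φ⁻¹`. -/
def eigenComponent (h : X →+ Y) : X →+ Y where
  toFun x := ∑ j ∈ Finset.range (orderOf (σ ^ m)), (skewGen A σ ^ m) ^ j •
    h ((orderOf (σ ^ m) : k)⁻¹ • ((charIso ζ φ i)⁻¹ ^ j) x)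
  map_zero' := by simp
  map_add' x y := by simp [Finset.sum_add_distrib]

theorem eigenComponent_apply (h : X →+ Y) (x : X) :
    eigenComponent ζ φ i h x = ∑ j ∈ Finset.range (orderOf (σ ^ m)), (skewGen A σ ^ m) ^ j •
      h ((orderOf (σ ^ m) : k)⁻¹ • ((charIso ζ φ i)⁻¹ ^ j) x) := rfl

theorem eigenComponent_smul {h : X →+ Y} (hA : ∀ (a : A) x, h (a • x) = baseHom A σ a • h x)
    (a : A) (x : X) :
    eigenComponent ζ φ i h (a • x) = baseHom A σ a • eigenComponent ζ φ i h x := by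
  rw [eigenComponent_apply, eigenComponent_apply, Finset.smul_sum]
  refine Finset.sum_congr rfl fun j _ => ?_
  have := IsScalarTower.to_smulCommClass (R := k) (A := A) (M := X)
  rw [charIso_inv_pow_smul, smul_comm, hA, smul_smul, smul_smul, ← pow_mul,
    skewGen_pow_mul_baseHom, pow_mul, smul_inv_smul]

theorem skewGen_pow_smul_eigenComponent (hmr : m * orderOf (σ ^ m) = orderOf σ)
    (hζ : IsPrimitiveRoot ζ (orderOf (σ ^ m))) (hφ : IsNormalizedIso φ) (h : X →+ Y) (x : X) :
    skewGen A σ ^ m • eigenComponent ζ φ i h x =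
      eigenComponent ζ φ i h (charIso ζ φ i x) := by
  set r := orderOf (σ ^ m) with hr
  set u := charIso ζ φ i
  let f : ℕ → Y := fun j => (skewGen A σ ^ m) ^ j • h ((r : k)⁻¹ • (u⁻¹ ^ j) (u x))
  have h0 : f r = f 0 := by
    simp only [f]
    rw [← pow_mul, hmr, skewGen_pow_orderOf, pow_zero, pow_zero, inv_pow,
      charIso_pow_orderOf i hζ hφ, inv_one]
  have h1 : ∀ j, skewGen A σ ^ m • (skewGen A σ ^ m) ^ j • h ((r : k)⁻¹ • (u⁻¹ ^ j) x) =
      f (j + 1) := by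
    intro j
    have h2 : (u⁻¹ ^ (j + 1)) (u x) = (u⁻¹ ^ j) x := by
      rw [pow_succ, LinearEquiv.mul_apply]
      exact congrArg _ (u.symm_apply_apply x)
    simp only [f]
    rw [h2, smul_smul, ← pow_succ']
  rw [eigenComponent_apply, eigenComponent_apply, Finset.smul_sum]
  change _ = ∑ j ∈ Finset.range r, f j
  rw [Finset.sum_congr rfl fun j _ => h1 j]
  have h3 := Finset.sum_range_succ f r
  rw [Finset.sum_range_succ', h0] at h3
  exact add_right_cancel h3

theorem sum_eigenComponent (hr : (orderOf (σ ^ m) : k) ≠ 0)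
    (hζ : IsPrimitiveRoot ζ (orderOf (σ ^ m))) (h : X →+ Y) (x : X) :
    ∑ i ∈ Finset.Icc 1 (orderOf (σ ^ m)), eigenComponent ζ φ i h x = h x := by
  simp only [eigenComponent_apply]
  rw [Finset.sum_comm]
  have hpos : 0 < orderOf (σ ^ m) := Nat.pos_of_ne_zero fun h => hr (by rw [h, Nat.cast_zero])
  rw [Finset.sum_eq_single_of_mem 0 (Finset.mem_range.2 hpos)]
  · have h1 : ∀ i ∈ Finset.Icc 1 (orderOf (σ ^ m)), (skewGen A σ ^ m) ^ 0 •
        h ((orderOf (σ ^ m) : k)⁻¹ • ((charIso ζ φ i)⁻¹ ^ 0) x) =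
        h ((orderOf (σ ^ m) : k)⁻¹ • x) := by
      intro i _
      rw [pow_zero, one_smul, pow_zero]
      rfl
    rw [Finset.sum_congr rfl h1, Finset.sum_const, Nat.card_Icc, Nat.add_sub_cancel, ← map_nsmul,
      ← Nat.cast_smul_eq_nsmul k, smul_inv_smul₀ hr]
  · intro j hj hj0
    rw [← Finset.smul_sum, ← map_sum, ← Finset.smul_sum]
    simp only [charIso_inv_pow_apply]
    rw [← Finset.sum_smul, hζ.sum_inv_pow_Icc (Finset.mem_range.1 hj), if_neg hj0, zero_smul,
      smul_zero, map_zero, smul_zero]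

end

theorem IsArtinian.bijective_of_injective_of_linearEquiv {R M N : Type*} [Ring R] [AddCommGroup M]
    [Module R M] [AddCommGroup N] [Module R N] [IsArtinian R M] (e : M ≃ₗ[R] N) (f : M →ₗ[R] N)
    (hf : Function.Injective f) : Function.Bijective f := by
  have h1 : Function.Injective (e.symm.toLinearMap ∘ₗ f) := e.symm.injective.comp hf
  have h2 : Function.Surjective (e.symm ∘ f) := (bijective_of_injective_endomorphism _ h1).2
  exact ⟨hf, h2.of_comp_left e.symm.injective⟩

/-! ### Modules over the skew group algebra and their restrictions -/

section
variable {G : Type*} [Group G] {A : Type*} [Ring A] [MulSemiringAction G A]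
  {X : Type*} [AddCommGroup X] [Module A X] {σ : G} {m : ℕ}
  {Y : Type*} [AddCommGroup Y] [Module (SkewMonoidAlgebra A (Subgroup.zpowers σ)) Y]
  {Z : Type*} [AddCommGroup Z] [Module (SkewMonoidAlgebra A (Subgroup.zpowers σ)) Z]

/-- The identity map `Y → Y|_R`. -/
def Restrict.of {R S : Type*} [Ring R] [Ring S] (f : R →+* S) {Y : Type*} [AddCommGroup Y]
    [Module S Y] : Y ≃+ Restrict f Y := AddEquiv.refl Y

/-- A homomorphism of `A`-modules to the restriction of `Y`. -/
def toRestrict (h : X →+ Y) (hA : ∀ (a : A) x, h (a • x) = baseHom A σ a • h x) :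
    X →ₗ[A] Restrict (baseHom A σ) Y where
  toFun := h
  map_add' := map_add h
  map_smul' := hA

/-- The restriction of a homomorphism of `A # k⟨σ⟩`-modules. -/
def restrictMap (F : Y →ₗ[SkewMonoidAlgebra A (Subgroup.zpowers σ)] Z) :
    Restrict (baseHom A σ) Y →ₗ[A] Restrict (baseHom A σ) Z where
  toFun := F
  map_add' := map_add F
  map_smul' a := F.map_smul (baseHom A σ a)

/-- The `A`-linear map `y ↦ p (g⁻¹ y)` to `ᵍX` defined by an `A`-linear map `p : Y → X`. -/
def twistProj (p : Restrict (baseHom A σ) Y →ₗ[A] X) (g : Subgroup.zpowers σ) :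
    Restrict (baseHom A σ) Y →ₗ[A] Twist (g : G) X where
  toFun y := Twist.of _ (p (Restrict.of _
    (SkewMonoidAlgebra.of A _ g⁻¹ • (Restrict.of (baseHom A σ)).symm y)))
  map_add' y z := by rw [map_add, smul_add, map_add, map_add, map_add]
  map_smul' a y := by
    have h1 : SkewMonoidAlgebra.of A _ g⁻¹ • (baseHom A σ a • (Restrict.of (baseHom A σ)).symm y) =
        baseHom A σ ((g : G)⁻¹ • a) •
          (SkewMonoidAlgebra.of A _ g⁻¹ • (Restrict.of (baseHom A σ)).symm y) := by
      rw [smul_smul, smul_smul, of_mul_baseHom]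
      rfl
    have h2 := p.map_smul ((g : G)⁻¹ • a) (Restrict.of _
      (SkewMonoidAlgebra.of A _ g⁻¹ • (Restrict.of (baseHom A σ)).symm y))
    rw [RingHom.id_apply, Twist.smul_of, ← h2]
    exact congrArg (fun y => Twist.of _ (p (Restrict.of _ y))) h1

/-- The isomorphism `^{σ^0}X ≅ X`. -/
def twistZeroEquiv (σ : G) : Twist (σ ^ 0) X ≃ₗ[A] X where
  __ := (Twist.of (σ ^ 0)).symm
  map_smul' a x := by
    have h : (σ ^ 0)⁻¹ • a = a := by rw [pow_zero, inv_one, one_smul]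
    exact congrArg (· • (Twist.of (σ ^ 0)).symm x) h

theorem isUnit_twistProj_comp_twistSumMap (h : X →+ Y)
    (hA : ∀ (a : A) x, h (a • x) = baseHom A σ a • h x)
    (p : Restrict (baseHom A σ) Y →ₗ[A] X)
    (hp : IsUnit (p ∘ₗ toRestrict h hA : Module.End A X)) (j : Fin m) :
    IsUnit (twistProj p ⟨σ ^ (j : ℕ), (j : ℕ), by simp⟩ ∘ₗ twistSumMap σ m h hA j :
      Module.End A (Twist (σ ^ (j : ℕ)) X)) := by
  rw [Module.End.isUnit_iff] at hp ⊢
  have h1 : ⇑(twistProj p ⟨σ ^ (j : ℕ), (j : ℕ), by simp⟩ ∘ₗ twistSumMap σ m h hA j :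
      Module.End A (Twist (σ ^ (j : ℕ)) X)) =
      Twist.of _ ∘ (p ∘ₗ toRestrict h hA : Module.End A X) ∘ (Twist.of _).symm := by
    funext x
    have h2 : ∀ y : Y, SkewMonoidAlgebra.of A _
        (⟨σ ^ (j : ℕ), (j : ℕ), by simp⟩ : Subgroup.zpowers σ)⁻¹ • skewGen A σ ^ (j : ℕ) • y = y := by
      intro y
      rw [skewGen_pow, smul_smul, ← map_mul, inv_mul_cancel, map_one, one_smul]
    exact congrArg (fun y => Twist.of _ (p y)) (h2 _)
  rw [h1]
  exact (Twist.of _).bijective.comp (hp.comp (Twist.of _).symm.bijective)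

/-- A module homomorphism from the induced module is injective if its restriction to `X` is a split
monomorphism of `A`-modules, because the twists `^{σ^j}X` are pairwise non-isomorphic. -/
theorem eq_zero_of_sum_twistSumMap_eq_zero [IsLocalRing (Module.End A X)]
    (hm : IsLeast {j : ℕ | 0 < j ∧ Nonempty (Twist (σ ^ j) X ≃ₗ[A] X)} m) (h : X →+ Y)
    (hA : ∀ (a : A) x, h (a • x) = baseHom A σ a • h x)
    (p : Restrict (baseHom A σ) Y →ₗ[A] X)
    (hp : IsUnit (p ∘ₗ toRestrict h hA : Module.End A X))
    (x : ∀ j : Fin m, Twist (σ ^ (j : ℕ)) X)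
    (hx : ∑ j : Fin m, twistSumMap σ m h hA j (x j) = 0) : x = 0 := by
  have : ∀ j : Fin m, IsLocalRing (Module.End A (Twist (σ ^ (j : ℕ)) X)) := fun j =>
    Twist.isLocalRing_end _
  funext j
  exact eq_zero_of_sum_split_eq_zero (fun i j hij => isEmpty_twist_pow_linearEquiv hm hij)
    Finset.univ (twistSumMap σ m h hA) (fun j => twistProj p ⟨σ ^ (j : ℕ), (j : ℕ), by simp⟩)
    (fun j _ => isUnit_twistProj_comp_twistSumMap h hA p hp j) x hx j (Finset.mem_univ j)

end

section
variable {k : Type*} [Field k] {G : Type*} [Group G]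
  {A : Type*} [Ring A] [Algebra k A] [MulSemiringAction G A] [SMulCommClass G k A]
  {X : Type*} [AddCommGroup X] [Module k X] [Module A X] [IsScalarTower k A X]

variable (k A X) in
theorem Twist.isArtinian [FiniteDimensional k X] (g : G) : IsArtinian A (Twist g X) := by
  let _ : Module k (Twist g X) := inferInstanceAs (Module k X)
  have : IsScalarTower k A (Twist g X) := ⟨fun c a x => by
    have h : ((g⁻¹ • (c • a)) • (Twist.of g).symm x : X) = c • ((g⁻¹ • a) • (Twist.of g).symm x) := by
      rw [smul_comm, smul_assoc]
    exact h⟩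
  have : Module.Finite k (Twist g X) := inferInstanceAs (Module.Finite k X)
  exact isArtinian_of_tower k inferInstance

variable {σ : G} {m : ℕ} {ζ : kˣ} {φ : Twist (σ ^ m) X ≃ₗ[A] X}
  {Y : Type*} [AddCommGroup Y] [Module (SkewMonoidAlgebra A (Subgroup.zpowers σ)) Y]

/-- If `X` is a direct summand of the restriction of `Y`, via a map `h : X → Y`, then one of the
induced modules embeds into `Y`: since `h` is the sum of its eigencomponents and `End X` is local,
one of these is a split monomorphism as well. -/
theorem exists_injective_of_isUnit [IsLocalRing (Module.End A X)]
    (hσ : 0 < orderOf σ) (hr : (orderOf (σ ^ m) : k) ≠ 0)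
    (hm : IsLeast {j : ℕ | 0 < j ∧ Nonempty (Twist (σ ^ j) X ≃ₗ[A] X)} m)
    (hζ : IsPrimitiveRoot ζ (orderOf (σ ^ m))) (hφ : IsNormalizedIso φ) (h : X →+ Y)
    (hA : ∀ (a : A) x, h (a • x) = baseHom A σ a • h x)
    (p : Restrict (baseHom A σ) Y →ₗ[A] X)
    (hp : IsUnit (p ∘ₗ toRestrict h hA : Module.End A X)) :
    ∃ i ∈ Finset.Icc 1 (orderOf (σ ^ m)),
      ∃ F : IndCharTensor hζ hφ i →ₗ[SkewMonoidAlgebra A (Subgroup.zpowers σ)] Y,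
        Function.Injective F := by
  have hmr := mul_orderOf_pow_eq_orderOf hm
  have hsum : (p ∘ₗ toRestrict h hA : Module.End A X) = ∑ i ∈ Finset.Icc 1 (orderOf (σ ^ m)),
      (p ∘ₗ toRestrict (eigenComponent ζ φ i h) (eigenComponent_smul i hA) :
        Module.End A X) := by
    refine LinearMap.ext fun x => ?_
    rw [LinearMap.sum_apply]
    change p (h x) = ∑ i ∈ Finset.Icc 1 (orderOf (σ ^ m)), p (eigenComponent ζ φ i h x)
    rw [← sum_eigenComponent (φ := φ) hr hζ h x]
    exact map_sum p (fun i => (eigenComponent ζ φ i h x : Y)) _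
  rw [hsum] at hp
  obtain ⟨i, hi, hu⟩ := IsLocalRing.exists_isUnit_of_isUnit_finset_sum _ _ hp
  refine ⟨i, hi, ?_⟩
  obtain ⟨F, hF⟩ := IndCharTensor.exists_lift hζ hφ i
    (Nat.pos_of_ne_zero fun h => hr (by rw [h, Nat.cast_zero]))
    (eigenComponent ζ φ i h) (eigenComponent_smul i hA)
    (skewGen_pow_smul_eigenComponent i hmr hζ hφ h)
  refine ⟨F, (injective_iff_map_eq_zero F).2 fun z hz => ?_⟩
  obtain ⟨x, hx⟩ := (IndCharTensor.twistEquiv hζ hφ i hσ hm.1.1 ⟨_, hmr.symm⟩).surjective z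
  have h1 : ∑ j : Fin m, twistSumMap σ m (eigenComponent ζ φ i h) (eigenComponent_smul i hA) j (x j)
      = 0 := by
    rw [IndCharTensor.twistEquiv_apply] at hx
    have h2 : restrictMap F (∑ j : Fin m, twistSumMap σ m (IndCharTensor.unit hζ hφ i)
        (IndCharTensor.unit_smul hζ hφ i) j (x j)) = 0 := by
      rw [hx]; exact hz
    rw [map_sum] at h2
    refine (Finset.sum_congr rfl fun j _ => ?_).trans h2
    have h3 : F (skewGen A σ ^ (j : ℕ) • IndCharTensor.unit hζ hφ i ((Twist.of _).symm (x j))) =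
        skewGen A σ ^ (j : ℕ) • eigenComponent ζ φ i h ((Twist.of _).symm (x j)) := by
      rw [map_smul, hF]
    exact h3.symm
  have h4 := eq_zero_of_sum_twistSumMap_eq_zero hm _ _ p hu x h1
  rw [← hx, h4]
  exact map_zero _

namespace IndCharTensor
variable (hσ : 0 < orderOf σ) (hm : 0 < m) (hd : m ∣ orderOf σ)
  (hζ : IsPrimitiveRoot ζ (orderOf (σ ^ m))) (hφ : IsNormalizedIso φ) (i : ℕ)

/-- The projection of the restriction of `(A # k⟨σ⟩) ⊗ (L_i ⊗ X)` to its summand `X`. -/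
def proj : Restrict (baseHom A σ) (IndCharTensor hζ hφ i) →ₗ[A] X :=
  (twistZeroEquiv (A := A) (X := X) σ).toLinearMap ∘ₗ
    (LinearMap.proj (⟨0, hm⟩ : Fin m) : (∀ j : Fin m, Twist (σ ^ (j : ℕ)) X) →ₗ[A] _) ∘ₗ
    (twistEquiv hζ hφ i hσ hm hd).symm.toLinearMap

theorem proj_twistEquiv (x : ∀ j : Fin m, Twist (σ ^ (j : ℕ)) X) :
    proj hσ hm hd hζ hφ i (twistEquiv hζ hφ i hσ hm hd x) = (Twist.of _).symm (x ⟨0, hm⟩) := by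
  change twistZeroEquiv (A := A) σ ((twistEquiv hζ hφ i hσ hm hd).symm (twistEquiv hζ hφ i hσ hm hd x)
    ⟨0, hm⟩) = _
  rw [LinearEquiv.symm_apply_apply]
  rfl

theorem twistEquiv_single_zero (x : X) :
    twistEquiv hζ hφ i hσ hm hd (Pi.single ⟨0, hm⟩ (Twist.of _ x)) = unit hζ hφ i x := by
  rw [twistEquiv_apply, Finset.sum_eq_single ⟨0, hm⟩]
  · rw [Pi.single_eq_same]
    exact (congrArg (· • unit hζ hφ i x) (pow_zero (skewGen A σ))).trans (one_smul _ _)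
  · intro j _ hj
    rw [Pi.single_eq_of_ne hj, map_zero]
  · simp

theorem proj_unit (x : X) : proj hσ hm hd hζ hφ i (unit hζ hφ i x) = x := by
  rw [← twistEquiv_single_zero hσ hm hd, proj_twistEquiv, Pi.single_eq_same]
  exact (Twist.of _).symm_apply_apply x

theorem proj_skewGen_pow_smul (z : IndCharTensor hζ hφ i) :
    proj hσ hm hd hζ hφ i (Restrict.of _ (skewGen A σ ^ m • z)) =
      charIso ζ φ i (proj hσ hm hd hζ hφ i (Restrict.of _ z)) := by
  obtain ⟨x, rfl⟩ := ((twistEquiv hζ hφ i hσ hm hd).toEquiv.trans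
    (Restrict.of (baseHom A σ)).symm.toEquiv).surjective z
  change proj hσ hm hd hζ hφ i (Restrict.of _ (skewGen A σ ^ m • (Restrict.of (baseHom A σ)).symm
    (twistEquiv hζ hφ i hσ hm hd x))) = charIso ζ φ i (proj hσ hm hd hζ hφ i
      (twistEquiv hζ hφ i hσ hm hd x))
  have h : Restrict.of (baseHom A σ) (skewGen A σ ^ m • (Restrict.of (baseHom A σ)).symm
      (twistEquiv hζ hφ i hσ hm hd x)) = twistEquiv hζ hφ i hσ hm hd fun j =>
        Twist.of _ (charIso ζ φ i ((Twist.of _).symm (x j))) := by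
    rw [twistEquiv_apply, twistEquiv_apply]
    rw [map_sum, Finset.smul_sum, map_sum]
    refine Finset.sum_congr rfl fun j _ => ?_
    have h1 : skewGen A σ ^ m • (skewGen A σ ^ (j : ℕ) • unit hζ hφ i ((Twist.of _).symm (x j))) =
        skewGen A σ ^ (j : ℕ) • unit hζ hφ i (charIso ζ φ i ((Twist.of _).symm (x j))) := by
      rw [← skewGen_pow_smul_unit, smul_smul, smul_smul, ← pow_add, ← pow_add, add_comm]
    exact h1
  rw [h, proj_twistEquiv, proj_twistEquiv]
  exact (Twist.of _).symm_apply_apply _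

variable (k) in
include hσ hm hd in
theorem isArtinian_restrict [FiniteDimensional k X] :
    IsArtinian A (Restrict (baseHom A σ) (IndCharTensor hζ hφ i)) := by
  have : ∀ j : Fin m, IsArtinian A (Twist (σ ^ (j : ℕ)) X) := fun j => Twist.isArtinian k A X _
  exact (twistEquiv hζ hφ i hσ hm hd).symm.isArtinian_iff.2 inferInstance

/-- An embedding of one induced module into another is an isomorphism, their restrictions being
isomorphic modules of finite length. -/
theorem bijective_of_injective (hσ : 0 < orderOf σ) (hm : 0 < m) (hd : m ∣ orderOf σ)
    [FiniteDimensional k X] {i j : ℕ}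
    (F : IndCharTensor hζ hφ i →ₗ[SkewMonoidAlgebra A (Subgroup.zpowers σ)]
      IndCharTensor hζ hφ j) (hF : Function.Injective F) : Function.Bijective F := by
  have := isArtinian_restrict k hσ hm hd hζ hφ i
  have h := IsArtinian.bijective_of_injective_of_linearEquiv
    ((twistEquiv hζ hφ i hσ hm hd).symm.trans (twistEquiv hζ hφ j hσ hm hd)) (restrictMap F) hF
  exact ⟨hF, h.2⟩

end IndCharTensor

end

/-! ### Classification of the modules restricting to the sum of the twists -/

section
variable {k : Type*} [Field k] {G : Type*} [Group G]
  {A : Type*} [Ring A] [Algebra k A] [MulSemiringAction G A] [SMulCommClass G k A]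
  {X : Type*} [AddCommGroup X] [Module k X] [Module A X] [IsScalarTower k A X]
  {σ : G} {m : ℕ} {ζ : kˣ} {φ : Twist (σ ^ m) X ≃ₗ[A] X}

namespace IndCharTensor

/-- A module that restricts to the sum of the twists is one of the induced modules: the embedding of
an induced module into it is an isomorphism, as both have the same restriction of finite length. -/
theorem exists_linearEquiv [FiniteDimensional k X] [IsLocalRing (Module.End A X)]
    (hσ : 0 < orderOf σ) (hr : (orderOf (σ ^ m) : k) ≠ 0)
    (hm : IsLeast {j : ℕ | 0 < j ∧ Nonempty (Twist (σ ^ j) X ≃ₗ[A] X)} m)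
    (hζ : IsPrimitiveRoot ζ (orderOf (σ ^ m))) (hφ : IsNormalizedIso φ)
    {Y : Type*} [AddCommGroup Y] [Module (SkewMonoidAlgebra A (Subgroup.zpowers σ)) Y]
    (e : Restrict (baseHom A σ) Y ≃ₗ[A] ∀ j : Fin m, Twist (σ ^ (j : ℕ)) X) :
    ∃ i ∈ Finset.Icc 1 (orderOf (σ ^ m)),
      Nonempty (Y ≃ₗ[SkewMonoidAlgebra A (Subgroup.zpowers σ)] IndCharTensor hζ hφ i) := by
  have hm0 := hm.1.1
  have hd : m ∣ orderOf σ := ⟨_, (mul_orderOf_pow_eq_orderOf hm).symm⟩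
  let h : X →ₗ[A] Restrict (baseHom A σ) Y := e.symm.toLinearMap ∘ₗ
    (LinearMap.single A (fun j : Fin m => Twist (σ ^ (j : ℕ)) X) ⟨0, hm0⟩) ∘ₗ
      (twistZeroEquiv (A := A) (X := X) σ).symm.toLinearMap
  let p : Restrict (baseHom A σ) Y →ₗ[A] X := (twistZeroEquiv (A := A) (X := X) σ).toLinearMap ∘ₗ
    (LinearMap.proj (⟨0, hm0⟩ : Fin m) : (∀ j : Fin m, Twist (σ ^ (j : ℕ)) X) →ₗ[A] _) ∘ₗ
    e.toLinearMap
  have hph : ∀ x, p (h x) = x := fun x => by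
    change twistZeroEquiv (A := A) (X := X) σ (e (e.symm (Pi.single ⟨0, hm0⟩
      ((twistZeroEquiv (A := A) (X := X) σ).symm x))) ⟨0, hm0⟩) = x
    rw [LinearEquiv.apply_symm_apply, Pi.single_eq_same]
    exact LinearEquiv.apply_symm_apply _ _
  obtain ⟨i, hi, F, hF⟩ := exists_injective_of_isUnit (k := k) hσ hr hm hζ hφ
    (Y := Y) h.toAddMonoidHom h.map_smul p (by
      convert isUnit_one (M := Module.End A X)
      exact LinearMap.ext hph)
  refine ⟨i, hi, ⟨(LinearEquiv.ofBijective F ⟨hF, ?_⟩).symm⟩⟩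
  have := isArtinian_restrict k hσ hm0 hd hζ hφ i
  exact (IsArtinian.bijective_of_injective_of_linearEquiv
    ((twistEquiv hζ hφ i hσ hm0 hd).symm.trans e.symm) (restrictMap F) hF).2

theorem isIndecomposableModule [FiniteDimensional k X] [IsLocalRing (Module.End A X)]
    (hσ : 0 < orderOf σ) (hr : (orderOf (σ ^ m) : k) ≠ 0)
    (hm : IsLeast {j : ℕ | 0 < j ∧ Nonempty (Twist (σ ^ j) X ≃ₗ[A] X)} m)
    (hζ : IsPrimitiveRoot ζ (orderOf (σ ^ m))) (hφ : IsNormalizedIso φ) (i : ℕ) :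
    IsIndecomposableModule (SkewMonoidAlgebra A (Subgroup.zpowers σ))
      (IndCharTensor hζ hφ i) := by
  have hm0 := hm.1.1
  have hd : m ∣ orderOf σ := ⟨_, (mul_orderOf_pow_eq_orderOf hm).symm⟩
  constructor
  · obtain ⟨f, hf⟩ := exists_ne (0 : Module.End A X)
    have : Nontrivial X := by
      by_contra hX
      rw [not_nontrivial_iff_subsingleton] at hX
      exact hf (LinearMap.ext fun x => Subsingleton.elim _ _)
    exact Function.Injective.nontrivial (f := unit hζ hφ i)
      (Function.LeftInverse.injective (proj_unit hσ hm0 hd hζ hφ i))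
  · -- the summand through which the inclusion of `X` splits is everything
    have key : ∀ (N P : Submodule (SkewMonoidAlgebra A (Subgroup.zpowers σ))
        (IndCharTensor hζ hφ i)) (h : IsCompl N P),
        IsUnit (proj hσ hm0 hd hζ hφ i ∘ₗ restrictMap (N.projection P h) ∘ₗ
          toRestrict (unit hζ hφ i) (unit_smul hζ hφ i) : Module.End A X) → P = ⊥ := by
      intro N P h hu
      obtain ⟨l, -, F, hF⟩ := exists_injective_of_isUnit (k := k) hσ hr hm hζ hφ (Y := N)
        ((N.projectionOnto P h).toAddMonoidHom.comp (unit hζ hφ i))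
        (fun a x => by
          change N.projectionOnto P h (unit hζ hφ i (a • x)) = _
          rw [unit_smul, map_smul]
          rfl)
        (proj hσ hm0 hd hζ hφ i ∘ₗ restrictMap N.subtype) hu
      have hb := bijective_of_injective hζ hφ hσ hm0 hd (N.subtype ∘ₗ F)
        (N.injective_subtype.comp hF)
      have hN : N = ⊤ := by
        rw [eq_top_iff]
        intro z _
        obtain ⟨y, rfl⟩ := hb.2 z
        exact (F y).2
      subst hN
      exact (top_disjoint.1 h.disjoint)
    intro N P h
    have hsum : (proj hσ hm0 hd hζ hφ i ∘ₗ restrictMap (N.projection P h) ∘ₗ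
          toRestrict (unit hζ hφ i) (unit_smul hζ hφ i) : Module.End A X) +
        (proj hσ hm0 hd hζ hφ i ∘ₗ restrictMap (P.projection N h.symm) ∘ₗ
          toRestrict (unit hζ hφ i) (unit_smul hζ hφ i) : Module.End A X) = 1 := by
      refine LinearMap.ext fun x => ?_
      rw [LinearMap.add_apply]
      refine (map_add (proj hσ hm0 hd hζ hφ i) (Restrict.of _ _) (Restrict.of _ _)).symm.trans ?_
      rw [← map_add]
      refine Eq.trans ?_ (proj_unit hσ hm0 hd hζ hφ i x)
      exact congrArg (fun y => proj hσ hm0 hd hζ hφ i (Restrict.of _ y))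
        (Submodule.projection_add_projection_eq_self h _)
    rcases IsLocalRing.isUnit_or_isUnit_of_add_one hsum with hu | hu
    · exact Or.inr (key N P h hu)
    · exact Or.inl (key P N h.symm hu)

/-- An automorphism `g` of `X` that commutes with `φ` up to a scalar commutes with it: if `x` is an
eigenvector of `g`, then so is `φ x`, with the eigenvalue changed by that scalar, but `g` has only one
eigenvalue. -/
theorem pow_eq_pow_of_intertwines [IsAlgClosed k] [FiniteDimensional k X]
    (hX : IsIndecomposableModule A X) {g : Module.End A X} (hg : IsUnit g) {i j : ℕ}
    (h : ∀ x, g (charIso ζ φ i x) = charIso ζ φ j (g x)) : ζ ^ i = ζ ^ j := by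
  have := hX.1
  obtain ⟨c, n, hn⟩ := hX.exists_isNilpotent_sub (k := k) g
  let g' : Module.End k X := g.restrictScalars k
  have hgk : ∀ (b : k) (x : X), g (b • x) = b • g x := g'.map_smul
  have huniq : ∀ (b : k) (x : X), x ≠ 0 → g x = b • x → b = c := by
    intro b x hx hb
    have h1 : ∀ n : ℕ, ((g - algebraMap k (Module.End A X) c) ^ n) x = (b - c) ^ n • x := by
      intro n
      induction n with
      | zero => simp
      | succ n ih =>
        rw [pow_succ', Module.End.mul_apply, ih, LinearMap.sub_apply, hgk, hb,
          Module.algebraMap_end_apply, pow_succ, ← smul_smul, smul_comm c, ← smul_sub, sub_smul]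
    have h3 := h1 n
    rw [hn, LinearMap.zero_apply] at h3
    have h4 := (smul_eq_zero.1 h3.symm).resolve_right hx
    by_contra hne
    exact pow_ne_zero n (sub_ne_zero.2 hne) h4
  obtain ⟨b, hb⟩ := Module.End.exists_eigenvalue g'
  obtain ⟨x, hx⟩ := hb.exists_hasEigenvector
  have hbx : g x = b • x := hx.apply_eq_smul
  have hbc := huniq b x hx.2 hbx
  rw [hbc] at hbx
  have hc : c ≠ 0 := by
    rintro rfl
    rw [zero_smul] at hbx
    exact hx.2 (((Module.End.isUnit_iff _).1 hg).1 (hbx.trans (map_zero g).symm))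
  set y := φ (Twist.of _ x)
  have hy : y ≠ 0 := by
    intro h0
    exact hx.2 ((Twist.of (σ ^ m)).map_eq_zero_iff.1 (φ.map_eq_zero_iff.1 h0))
  have h1 := h x
  rw [hbx, charIso_apply, charIso_apply] at h1
  have h2 : φ (Twist.of _ (c • x)) = c • y := (Twist.underlying (k := k) φ).map_smul c x
  rw [h2, hgk] at h1
  have h4 : g y = ((ζ⁻¹ : kˣ) : k) ^ i • ((ζ : k) ^ j * c) • y := by
    rw [mul_smul, ← h1, smul_smul, ← mul_pow, Units.inv_mul, one_pow, one_smul]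
  rw [smul_smul] at h4
  have h5 := huniq _ y hy h4
  rw [← mul_assoc] at h5
  have h6 := mul_right_cancel₀ hc (h5.trans (one_mul c).symm)
  have h7 : ζ⁻¹ ^ i * ζ ^ j = 1 := Units.ext (by
    rw [Units.val_mul, Units.val_pow_eq_pow_val, Units.val_pow_eq_pow_val, h6, Units.val_one])
  rw [inv_pow, inv_mul_eq_one] at h7
  exact h7

/-- An isomorphism `M_i ≅ M_j` yields, by restriction to `X` and projection to `X`, an automorphism
of `X` that intertwines `ζ ^ i φ` and `ζ ^ j φ`. -/
theorem pow_eq_pow_of_linearEquiv [IsAlgClosed k] [FiniteDimensional k X]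
    (hX : IsIndecomposableModule A X) (hσ : 0 < orderOf σ)
    (hm : IsLeast {j : ℕ | 0 < j ∧ Nonempty (Twist (σ ^ j) X ≃ₗ[A] X)} m)
    (hζ : IsPrimitiveRoot ζ (orderOf (σ ^ m))) (hφ : IsNormalizedIso φ) {i j : ℕ}
    (F : IndCharTensor hζ hφ i ≃ₗ[SkewMonoidAlgebra A (Subgroup.zpowers σ)]
      IndCharTensor hζ hφ j) : ζ ^ i = ζ ^ j := by
  have : IsArtinian A X := isArtinian_of_tower k inferInstance
  have : IsNoetherian A X := isNoetherian_of_tower k inferInstance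
  have := hX.isLocalRing_end
  have : ∀ l : Fin m, IsLocalRing (Module.End A (Twist (σ ^ (l : ℕ)) X)) := fun l =>
    Twist.isLocalRing_end _
  have hm0 := hm.1.1
  have hd : m ∣ orderOf σ := ⟨_, (mul_orderOf_pow_eq_orderOf hm).symm⟩
  let h : X →ₗ[A] Restrict (baseHom A σ) (IndCharTensor hζ hφ j) :=
    restrictMap F.toLinearMap ∘ₗ toRestrict (unit hζ hφ i) (unit_smul hζ hφ i)
  let p : Restrict (baseHom A σ) (IndCharTensor hζ hφ j) →ₗ[A] X :=
    proj hσ hm0 hd hζ hφ i ∘ₗ restrictMap F.symm.toLinearMap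
  let g : Module.End A X := proj hσ hm0 hd hζ hφ j ∘ₗ h
  have hph : (p ∘ₗ h : Module.End A X) = 1 := by
    refine LinearMap.ext fun x => ?_
    have h1 : F.symm (F (unit hζ hφ i x)) = unit hζ hφ i x := F.symm_apply_apply _
    exact (congrArg (fun y => proj hσ hm0 hd hζ hφ i (Restrict.of _ y)) h1).trans
      (proj_unit hσ hm0 hd hζ hφ i x)
  have hsum : (p ∘ₗ h : Module.End A X) = ∑ l : Fin m,
      ((p ∘ₗ twistSumMap σ m (unit hζ hφ j) (unit_smul hζ hφ j) l) ∘ₗ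
        (LinearMap.proj l ∘ₗ (twistEquiv hζ hφ j hσ hm0 hd).symm.toLinearMap ∘ₗ h) :
          Module.End A X) := by
    refine LinearMap.ext fun x => ?_
    have h2 := twistEquiv_apply hζ hφ j hσ hm0 hd ((twistEquiv hζ hφ j hσ hm0 hd).symm (h x))
    rw [LinearEquiv.apply_symm_apply] at h2
    rw [LinearMap.sum_apply, LinearMap.comp_apply, h2, map_sum]
    rfl
  have hu : IsUnit (∑ l : Fin m,
      ((p ∘ₗ twistSumMap σ m (unit hζ hφ j) (unit_smul hζ hφ j) l) ∘ₗ
        (LinearMap.proj l ∘ₗ (twistEquiv hζ hφ j hσ hm0 hd).symm.toLinearMap ∘ₗ h) :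
          Module.End A X)) := by
    rw [← hsum, hph]; exact isUnit_one
  obtain ⟨l, -, hl⟩ := IsLocalRing.exists_isUnit_of_isUnit_finset_sum _ _ hu
  -- only the component in `X` itself can be an isomorphism
  have hl0 : l = ⟨0, hm0⟩ := by
    by_contra hne
    have hE := isEmpty_twist_pow_linearEquiv hm (Ne.symm hne)
    refine not_isUnit_comp_of_isEmpty_linearEquiv (N := Twist (σ ^ (l : ℕ)) X) ?_ _ _ hl
    exact ⟨fun e => hE.elim ((twistZeroEquiv (A := A) (X := X) σ).trans e)⟩
  subst hl0
  have hg : IsUnit g := by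
    rw [Module.End.isUnit_iff] at hl ⊢
    apply IsArtinian.bijective_of_injective_endomorphism
    have h3 := Function.Injective.of_comp (f := (p ∘ₗ twistSumMap σ m (unit hζ hφ j)
      (unit_smul hζ hφ j) ⟨0, hm0⟩)) (g := (LinearMap.proj (⟨0, hm0⟩ : Fin m) ∘ₗ
        (twistEquiv hζ hφ j hσ hm0 hd).symm.toLinearMap ∘ₗ h)) hl.1
    exact (twistZeroEquiv (A := A) (X := X) σ).injective.comp h3
  refine pow_eq_pow_of_intertwines (ζ := ζ) (φ := φ) hX hg fun x => ?_
  have h4 : F (unit hζ hφ i (charIso ζ φ i x)) = skewGen A σ ^ m • F (unit hζ hφ i x) := by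
    rw [← skewGen_pow_smul_unit, map_smul]
  exact (congrArg (fun y => proj hσ hm0 hd hζ hφ j (Restrict.of _ y)) h4).trans
    (proj_skewGen_pow_smul hσ hm0 hd hζ hφ j _)

/-- The eigencomponents of `X → M_l` with respect to the action of `σ ^ m` all vanish but one. -/
theorem eigenComponent_unit (hr : (orderOf (σ ^ m) : k) ≠ 0)
    (hζ : IsPrimitiveRoot ζ (orderOf (σ ^ m))) (hφ : IsNormalizedIso φ) {i l : ℕ}
    (hi : i ∈ Finset.Icc 1 (orderOf (σ ^ m))) (hl : l ∈ Finset.Icc 1 (orderOf (σ ^ m))) (x : X) :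
    eigenComponent ζ φ i (unit hζ hφ l) x = if i = l then unit hζ hφ l x else 0 := by
  set r := orderOf (σ ^ m)
  have hpow : ∀ (n : ℕ) (x : X), (skewGen A σ ^ m) ^ n • unit hζ hφ l x =
      unit hζ hφ l ((charIso ζ φ l ^ n) x) := by
    intro n
    induction n with
    | zero => intro x; rw [pow_zero, one_smul, pow_zero]; rfl
    | succ n ih => intro x; rw [pow_succ, mul_smul, skewGen_pow_smul_unit, ih, pow_succ]; rfl
  rw [eigenComponent_apply]
  simp only [hpow, map_smul, charIso_pow_inv_pow_apply]
  rw [← map_sum, ← Finset.smul_sum, ← Finset.sum_smul]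
  split_ifs with h
  · subst h
    simp only [mul_inv_cancel, Units.val_one, one_pow, Finset.sum_const, Finset.card_range,
      nsmul_eq_mul, mul_one]
    rw [inv_smul_smul₀ hr]
  · rw [geom_sum_eq_zero_of_pow_eq_one, zero_smul, smul_zero, map_zero]
    · rw [← Units.val_pow_eq_pow_val, mul_pow, inv_pow, ← pow_mul, ← pow_mul, mul_comm l,
        mul_comm i, pow_mul, pow_mul, hζ.pow_eq_one]
      simp
    · intro h1
      rw [Units.val_eq_one, mul_inv_eq_one] at h1
      exact h (hζ.eq_of_pow_eq_pow_of_mem_Icc hi hl h1.symm)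

/-- The module induced from `X` is the direct sum of the modules `M_i`. -/
theorem nonempty_induced_linearEquiv (hr : (orderOf (σ ^ m) : k) ≠ 0)
    (hmr : m * orderOf (σ ^ m) = orderOf σ)
    (hζ : IsPrimitiveRoot ζ (orderOf (σ ^ m))) (hφ : IsNormalizedIso φ) :
    Nonempty (Induced (baseHom A σ) X ≃ₗ[SkewMonoidAlgebra A (Subgroup.zpowers σ)]
      ∀ i : Finset.Icc 1 (orderOf (σ ^ m)), IndCharTensor hζ hφ (i : ℕ)) := by
  have hτ : 0 < orderOf (σ ^ m) := Nat.pos_of_ne_zero fun h => hr (by rw [h, Nat.cast_zero])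
  let h : X →+ Induced (baseHom A σ) X := Induced.unit (baseHom A σ)
  have hA : ∀ (a : A) x, h (a • x) = baseHom A σ a • h x := Induced.unit_smul _
  choose F hF using fun i : ℕ => exists_lift hζ hφ i hτ (eigenComponent ζ φ i h)
    (eigenComponent_smul i hA) (skewGen_pow_smul_eigenComponent i hmr hζ hφ h)
  let D : ∀ i : ℕ, Induced (baseHom A σ) X →ₗ[SkewMonoidAlgebra A (Subgroup.zpowers σ)]
    IndCharTensor hζ hφ i := fun i =>
      Induced.lift (baseHom A σ) (unit hζ hφ i) (unit_smul hζ hφ i)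
  have hD : ∀ i x, D i (h x) = unit hζ hφ i x := fun i x => Induced.lift_unit _ _ _ x
  let F' : (∀ i : Finset.Icc 1 (orderOf (σ ^ m)), IndCharTensor hζ hφ (i : ℕ))
      →ₗ[SkewMonoidAlgebra A (Subgroup.zpowers σ)] Induced (baseHom A σ) X :=
    ∑ i : Finset.Icc 1 (orderOf (σ ^ m)), F i ∘ₗ LinearMap.proj i
  refine ⟨LinearEquiv.ofLinearMap (LinearMap.pi fun i => D i) F' ?_ ?_⟩
  · refine LinearMap.pi_ext' fun i => hom_ext fun x => funext fun l => ?_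
    have h1 : F' (Pi.single i (unit hζ hφ i x)) = eigenComponent ζ φ i h x := by
      rw [LinearMap.sum_apply, Finset.sum_eq_single i]
      · change F i (Pi.single (M := fun i : Finset.Icc 1 (orderOf (σ ^ m)) =>
          IndCharTensor hζ hφ (i : ℕ)) i (unit hζ hφ i x) i) = _
        rw [Pi.single_eq_same, hF]
      · intro j _ hj
        change F j (Pi.single (M := fun i : Finset.Icc 1 (orderOf (σ ^ m)) =>
          IndCharTensor hζ hφ (i : ℕ)) i (unit hζ hφ i x) j) = _
        rw [Pi.single_eq_of_ne hj, map_zero]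
      · simp
    have h2 : D l (eigenComponent ζ φ i h x) = eigenComponent ζ φ i (unit hζ hφ l) x := by
      rw [eigenComponent_apply, eigenComponent_apply, map_sum]
      simp only [map_smul, hD]
    change D l (F' (Pi.single i (unit hζ hφ i x))) = Pi.single (M := fun i :
      Finset.Icc 1 (orderOf (σ ^ m)) => IndCharTensor hζ hφ (i : ℕ)) i (unit hζ hφ i x) l
    rw [h1, h2, eigenComponent_unit hr hζ hφ i.2 l.2]
    split_ifs with hil
    · obtain rfl := Subtype.ext hil
      rw [Pi.single_eq_same]
    · rw [Pi.single_eq_of_ne fun h => hil (congrArg _ h.symm)]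
  · refine Induced.hom_ext _ fun x => ?_
    have h1 : F' (LinearMap.pi (fun i : Finset.Icc 1 (orderOf (σ ^ m)) => D i) (h x)) =
        ∑ i : Finset.Icc 1 (orderOf (σ ^ m)), eigenComponent ζ φ i h x := by
      rw [LinearMap.sum_apply]
      refine Finset.sum_congr rfl fun i _ => ?_
      change F i (D i (h x)) = _
      rw [hD, hF]
    rw [Finset.sum_coe_sort (Finset.Icc 1 (orderOf (σ ^ m)))
      (fun i => eigenComponent ζ φ i h x), sum_eigenComponent hr hζ] at h1
    exact h1

end IndCharTensor

end

/-! ### Counting isomorphism classes -/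

/-- The isomorphism classes of the modules with a property `P` are counted by a family `M` of pairwise
non-isomorphic modules, in any universe, that represents them. -/
theorem ModuleCat.ncard_image_quotient_mk {S : Type*} [Ring S] (s : Finset ℕ)
    (P : ModuleCat.{x} S → Prop)
    (M : ℕ → Type*) [∀ i, AddCommGroup (M i)] [∀ i, Module S (M i)]
    (hsmall : ∀ i ∈ s, ∃ Y : ModuleCat.{x} S, P Y ∧ Nonempty (Y ≃ₗ[S] M i))
    (hP : ∀ Y, P Y → ∃ i ∈ s, Nonempty (Y ≃ₗ[S] M i))
    (hM : ∀ i ∈ s, ∀ j ∈ s, Nonempty (M i ≃ₗ[S] M j) → i = j) :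
    (Quotient.mk (isIsomorphicSetoid (ModuleCat.{x} S)) '' {Y | P Y}).ncard = s.card := by
  choose! Z hPZ hZ using hsmall
  have h1 : Quotient.mk (isIsomorphicSetoid (ModuleCat.{x} S)) '' {Y | P Y} =
      (fun i => Quotient.mk (isIsomorphicSetoid (ModuleCat.{x} S)) (Z i)) '' (s : Set ℕ) := by
    ext q
    constructor
    · rintro ⟨Y, hY, rfl⟩
      obtain ⟨i, hi, ⟨e⟩⟩ := hP Y hY
      obtain ⟨e'⟩ := hZ i hi
      exact ⟨i, hi, Quotient.sound ⟨(e'.trans e.symm).toModuleIso⟩⟩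
    · rintro ⟨i, hi, rfl⟩
      exact ⟨Z i, hPZ i hi, rfl⟩
  rw [h1, Set.InjOn.ncard_image, Set.ncard_coe_finset]
  intro i hi j hj hij
  obtain ⟨e⟩ := Quotient.exact hij
  obtain ⟨ei⟩ := hZ i hi
  obtain ⟨ej⟩ := hZ j hj
  exact hM i hi j hj ⟨(ei.symm.trans e.toLinearEquiv).trans ej⟩

/-- The restriction of an isomorphism of `A # k⟨σ⟩`-modules. -/
def restrictEquiv {G : Type*} [Group G] {A : Type*} [Ring A] [MulSemiringAction G A] {σ : G}
    {Y : Type*} [AddCommGroup Y] [Module (SkewMonoidAlgebra A (Subgroup.zpowers σ)) Y]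
    {Z : Type*} [AddCommGroup Z] [Module (SkewMonoidAlgebra A (Subgroup.zpowers σ)) Z]
    (F : Y ≃ₗ[SkewMonoidAlgebra A (Subgroup.zpowers σ)] Z) :
    Restrict (baseHom A σ) Y ≃ₗ[A] Restrict (baseHom A σ) Z where
  __ := F.toAddEquiv
  map_smul' a := F.map_smul (baseHom A σ a)

end

theorem theorem4p8 {k : Type w} [Field k] [IsAlgClosed k]
    {Q : Type u} [Quiver.{v} Q] [Fintype Q] [∀ a b : Q, Finite (a ⟶ b)]
    (hconn : ∀ a b : Q, Nonempty (@Quiver.Path (Quiver.Symmetrify Q) _ a b))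
    (hacyc : ∀ (a : Q) (p : Quiver.Path a a), p.length = 0)
    (σ : QuiverAut Q) (hchar : ¬ ringChar k ∣ orderOf σ)
    {X : Type x} [AddCommGroup X] [Module k X] [Module (PathAlgebra k Q) X]
    [IsScalarTower k (PathAlgebra k Q) X] [Module.Finite (PathAlgebra k Q) X]
    (hX : IsIndecomposableModule (PathAlgebra k Q) X)
    (m : ℕ) (hm : IsLeast {j : ℕ | 0 < j ∧
      Nonempty (Twist (σ ^ j) X ≃ₗ[PathAlgebra k Q] X)} m) :
    -- `r = n / m` is an integer, equal to the order of `σ ^ m`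
    m * orderOf (σ ^ m) = orderOf σ ∧
    -- `X` carries an induced `kQ # k⟨σ ^ m⟩`-module structure
    (∃ φ : Twist (σ ^ m) X ≃ₗ[PathAlgebra k Q] X, IsNormalizedIso φ) ∧
    ∀ (φ : Twist (σ ^ m) X ≃ₗ[PathAlgebra k Q] X) (hφ : IsNormalizedIso φ)
      (ζ : kˣ) (hζ : IsPrimitiveRoot ζ (orderOf (σ ^ m))),
      -- restriction of the induced modules to `kQ`
      (∀ i ∈ Finset.Icc 1 (orderOf (σ ^ m)),
        Nonempty (Restrict (baseHom (PathAlgebra k Q) σ)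
            (InducedCharTensor σ m hζ hφ i)
          ≃ₗ[PathAlgebra k Q] TwistSum σ X m)) ∧
      -- the induced modules are indecomposable
      (∀ i ∈ Finset.Icc 1 (orderOf (σ ^ m)),
        IsIndecomposableModule (SkewPathAlgebra k σ)
          (InducedCharTensor σ m hζ hφ i)) ∧
      -- the induced modules are pairwise non-isomorphic
      (∀ i ∈ Finset.Icc 1 (orderOf (σ ^ m)), ∀ j ∈ Finset.Icc 1 (orderOf (σ ^ m)), i ≠ j →
        IsEmpty (InducedCharTensor σ m hζ hφ i
          ≃ₗ[SkewPathAlgebra k σ]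
            InducedCharTensor σ m hζ hφ j)) ∧
      -- their direct sum is the module induced from the `kQ`-module `X`
      Nonempty (Induced (baseHom (PathAlgebra k Q) σ) X
        ≃ₗ[SkewPathAlgebra k σ]
          ⨁ i : Finset.Icc 1 (orderOf (σ ^ m)),
            InducedCharTensor σ m hζ hφ (i : ℕ)) ∧
      -- every module with that restriction is isomorphic to exactly one of them
      (∀ (Y : Type y) [AddCommGroup Y]
        [Module (SkewPathAlgebra k σ) Y],
        Nonempty (Restrict (baseHom (PathAlgebra k Q) σ) Y
          ≃ₗ[PathAlgebra k Q] TwistSum σ X m) →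
        ∃! i : ℕ, i ∈ Finset.Icc 1 (orderOf (σ ^ m)) ∧
          Nonempty (Y ≃ₗ[SkewPathAlgebra k σ]
            InducedCharTensor σ m hζ hφ i)) ∧
      -- the number of isomorphism classes of modules with that restriction
      (Quotient.mk (isIsomorphicSetoid
          (ModuleCat.{x} (SkewPathAlgebra k σ))) ''
        {Y | Nonempty (Restrict (baseHom (PathAlgebra k Q) σ) Y
          ≃ₗ[PathAlgebra k Q] TwistSum σ X m)}).ncard
        = orderOf (σ ^ m) := by
  have hσ : 0 < orderOf σ := Nat.pos_of_ne_zero fun h => hchar (h ▸ dvd_zero _)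
  have hmr := mul_orderOf_pow_eq_orderOf hm
  have hm0 := hm.1.1
  have hd : m ∣ orderOf σ := ⟨_, hmr.symm⟩
  have hr : (orderOf (σ ^ m) : k) ≠ 0 := fun h =>
    hchar (((ringChar.spec k _).1 h).trans ⟨m, by rw [mul_comm]; exact hmr.symm⟩)
  have := PathAlgebra.finite_of_acyclic k hacyc
  have : Module.Finite k X := Module.Finite.trans (PathAlgebra k Q) X
  have : IsArtinian (PathAlgebra k Q) X := isArtinian_of_tower k inferInstance
  have : IsNoetherian (PathAlgebra k Q) X := isNoetherian_of_tower k inferInstance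
  have := hX.isLocalRing_end
  obtain ⟨φ₀⟩ := hm.1.2
  refine ⟨hmr, exists_isNormalizedIso k hX hr φ₀, fun φ hφ ζ hζ => ?_⟩
  let D := (DirectSum.linearEquivFunOnFintype (PathAlgebra k Q) (Fin m)
    (fun j => Twist (σ ^ (j : ℕ)) X))
  have hrestr : ∀ i : ℕ, Nonempty (Restrict (baseHom (PathAlgebra k Q) σ)
      (InducedCharTensor σ m hζ hφ i) ≃ₗ[PathAlgebra k Q] TwistSum σ X m) := fun i =>
    ⟨(IndCharTensor.twistEquiv hζ hφ i hσ hm0 hd).symm.trans D.symm⟩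
  have hne : ∀ i ∈ Finset.Icc 1 (orderOf (σ ^ m)), ∀ j ∈ Finset.Icc 1 (orderOf (σ ^ m)),
      Nonempty (InducedCharTensor σ m hζ hφ i ≃ₗ[SkewPathAlgebra k σ]
        InducedCharTensor σ m hζ hφ j) → i = j := fun i hi j hj ⟨e⟩ =>
    hζ.eq_of_pow_eq_pow_of_mem_Icc hi hj
      (IndCharTensor.pow_eq_pow_of_linearEquiv hX hσ hm hζ hφ e)
  refine ⟨fun i _ => hrestr i,
    fun i _ => IndCharTensor.isIndecomposableModule hσ hr hm hζ hφ i,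
    fun i hi j hj hij => not_nonempty_iff.1 fun h => hij (hne i hi j hj h), ?_, ?_, ?_⟩
  · obtain ⟨e⟩ := IndCharTensor.nonempty_induced_linearEquiv hr hmr hζ hφ
    exact ⟨e.trans (DirectSum.linearEquivFunOnFintype _ _ _).symm⟩
  · intro Y _ _ ⟨e⟩
    obtain ⟨i, hi, ⟨F⟩⟩ := IndCharTensor.exists_linearEquiv hσ hr hm hζ hφ (e.trans D)
    exact ⟨i, ⟨hi, ⟨F⟩⟩, fun j ⟨hj, ⟨F'⟩⟩ => hne j hj i hi ⟨F'.symm.trans F⟩⟩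
  · refine (ModuleCat.ncard_image_quotient_mk (Finset.Icc 1 (orderOf (σ ^ m))) _
      (fun i => InducedCharTensor σ m hζ hφ i) (fun i _ => ?_) (fun Y ⟨e⟩ => ?_) hne).trans
      (by rw [Nat.card_Icc, Nat.add_sub_cancel])
    · obtain ⟨e⟩ := hrestr i
      -- the induced module lives in a larger universe than `X`, but its restriction does not
      have : Small.{x} (InducedCharTensor σ m hζ hφ i) := ⟨TwistSum σ X m, ⟨e.toEquiv⟩⟩
      let f := Shrink.linearEquiv (SkewPathAlgebra k σ) (InducedCharTensor σ m hζ hφ i)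
      exact ⟨ModuleCat.of _ (Shrink.{x} (InducedCharTensor σ m hζ hφ i)),
        ⟨(restrictEquiv f).trans e⟩, ⟨f⟩⟩
    · exact IndCharTensor.exists_linearEquiv hσ hr hm hζ hφ (e.trans D)
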